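/- Let $m\ge 2$ be an integer, $\omega>0$, $h=1/N$ with $N\ge 1$ an integer, and $h\omega\le 1$. Let $$G_m(x)=\frac{(-1)^m\,\mathrm{sign}(x)}{4\omega^{2m-1}}\Big[(2m-3)\sin(\omega x)-\omega x\cos(\omega x)+2\sum_{k=1}^{m-2}\frac{(-1)^k(m-k-1)(\omega x)^{2k-1}}{(2k-1)!}\Big].$$ For functions $\varphi(h\beta),\psi(h\beta)$ of $\beta\in\mathbb Z$, the convolution is $\varphi(h\beta)*\psi(h\beta)=\sum_{\gamma\in\mathbb Z}\varphi(h\gamma)\psi(h\beta-h\gamma)$, where the series is required to converge absolutely for every $\beta$, and $\delta_d(h\beta)$ is $1$ for $\beta=0$ and $0$ for $\beta\ne0$. Let $$\mathcal P_{2m-2}(x)=\sum_{s}p_s^{(2m-2)}x^s=(1-x)^{2m-4}\Big[a x^2+\big(2h\omega-(2m-3)\sin(2h\omega)\big)x+a\Big]$$ $$\qquad+2(x^2-2x\cos h\omega+1)^2\sum_{k=1}^{m-2}\frac{(-1)^k(m-k-1)(h\omega)^{2k-1}(1-x)^{2m-2k-4}E_{2k-2}(x)}{(2k-1)!},$$ where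 $a=(2m-3)\sin h\omega-h\omega\cos h\omega$, $E_0=1$, and $E_k(x)=\frac{(1-x)^{k+2}}{x}\big(x\frac{d}{dx}\big)^k\frac{x}{(1-x)^2}$ are the Euler–Frobenius polynomials. Then: 1. $\mathcal P_{2m-2}$ has degree exactly $2m-2$, with leading coefficient $$p_{2m-2}^{(2m-2)}=(2m-3)\sin h\omega-h\omega\cos h\omega+2\sum_{k=1}^{m-2}\frac{(-1)^k(m-k-1)(h\omega)^{2k-1}}{(2k-1)!}.$$ 2. $\mathcal P_{2m-2}$ has exactly $m-1$ distinct complex roots $\lambda_1,\dots,\lambda_{m-1}$ of modulus less than $1$; they are real, nonzero and simple. 3. There is exactly one function $D_m:h\mathbb Z\to\mathbb R$ satisfying $D_m(h\beta)*G_m(h\beta)=\delta_d(h\beta)$ for all $\beta\in\mathbb Z$ (the discrete analogue of the operator $\frac{d^{2m}}{dx^{2m}}+2\omega^2\frac{d^{2m-2}}{dx^{2m-2}}+\omega^4\frac{d^{2m-4}}{dx^{2m-4}}$), and it is $$D_m(h\beta)=\frac{2\omega^{2m-1}}{(-1)^m p_{2m-2}^{(2m-2)}}\begin{cases}\sum_{k=1}^{m-1}A_k\lambda_k^{|\beta|-1},&|\beta|\ge2,\\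 1+\sum_{k=1}^{m-1}A_k,&|\beta|=1,\\ C+\sum_{k=1}^{m-1}\frac{A_k}{\lambda_k},&\beta=0,\end{cases}$$ where $$A_k=\frac{(1-\lambda_k)^{2m-4}(\lambda_k^2-2\lambda_k\cos h\omega+1)^2\,p_{2m-2}^{(2m-2)}}{\lambda_k\,\mathcal P_{2m-2}'(\lambda_k)},\qquad C=4-4\cos h\omega-2m-\frac{p_{2m-3}^{(2m-2)}}{p_{2m-2}^{(2m-2)}}.$$ -/

import Mathlib

open Polynomial Finset

noncomputable section

/-- The Euler–Frobenius polynomials, by the recursion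
`E₀ = 1`, `E_{k+1} = (1 + (k+1) x) E_k + x (1 - x) E_k'`.
That these are the polynomials
`E_k(x) = (1 - x)^(k+2) / x * (x d/dx)^k (x / (1 - x)^2)` is proved in `eulerFrobenius_eval`. -/
def eulerFrobenius : ℕ → ℝ[X]
  | 0 => 1
  | k + 1 => (1 + C ((k : ℝ) + 1) * X) * eulerFrobenius k
      + X * (1 - X) * derivative (eulerFrobenius k)

/-- The operator `x d/dx`. -/
def xDeriv (f : ℝ → ℝ) : ℝ → ℝ := fun x => x * deriv f x

theorem xDeriv_iterate_eq (k : ℕ) : ∀ x : ℝ, x ≠ 1 →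
    (xDeriv^[k] (fun y => y / (1 - y) ^ 2)) x
      = x * (eulerFrobenius k).eval x / (1 - x) ^ (k + 2) := by
  induction k with
  | zero => intro x _; simp [eulerFrobenius]
  | succ k ih =>
    intro x hx
    rw [Function.iterate_succ_apply']
    have hev : (xDeriv^[k] (fun y => y / (1 - y) ^ 2)) =ᶠ[nhds x]
        fun y => y * (eulerFrobenius k).eval y / (1 - y) ^ (k + 2) := by
      filter_upwards [isOpen_ne.mem_nhds hx] with y hy using ih y hy
    have h1 : (1 - x) ≠ 0 := sub_ne_zero.mpr (Ne.symm hx)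
    have hd : HasDerivAt (fun y => y * (eulerFrobenius k).eval y / (1 - y) ^ (k + 2))
        (((1 * (eulerFrobenius k).eval x + x * (derivative (eulerFrobenius k)).eval x)
          * (1 - x) ^ (k + 2) - (x * (eulerFrobenius k).eval x)
          * (((k + 2 : ℕ) : ℝ) * (1 - x) ^ (k + 1) * (-1))) / ((1 - x) ^ (k + 2)) ^ 2) x := by
      have hb : HasDerivAt (fun y : ℝ => (1 - y) ^ (k + 2))
          (((k + 2 : ℕ) : ℝ) * (1 - x) ^ (k + 1) * (-1)) x := by
        have h := ((hasDerivAt_id x).const_sub 1).fun_pow (k + 2)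
        simpa using h
      exact ((hasDerivAt_id x).mul ((eulerFrobenius k).hasDerivAt x)).div hb (pow_ne_zero _ h1)
    change x * deriv (xDeriv^[k] (fun y => y / (1 - y) ^ 2)) x = _
    rw [hev.deriv_eq, hd.deriv]
    simp only [eulerFrobenius, eval_add, eval_mul, eval_one, eval_C, eval_X, eval_sub]
    push_cast
    field_simp
    ring

theorem eulerFrobenius_eval (k : ℕ) (x : ℝ) (h0 : x ≠ 0) (h1 : x ≠ 1) :
    (eulerFrobenius k).eval x
      = (1 - x) ^ (k + 2) / x * (xDeriv^[k] (fun y => y / (1 - y) ^ 2)) x := by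
  rw [xDeriv_iterate_eq k x h1]
  have h2 : (1 - x) ≠ 0 := sub_ne_zero.mpr (Ne.symm h1)
  field_simp

/-- The function `G_m(x)` on the real line. -/
def greenFun (m : ℕ) (ω x : ℝ) : ℝ :=
  (-1) ^ m * Real.sign x / (4 * ω ^ (2 * m - 1)) *
    ((2 * (m : ℝ) - 3) * Real.sin (ω * x) - ω * x * Real.cos (ω * x)
      + 2 * ∑ k ∈ Icc 1 (m - 2),
          (-1) ^ k * ((m : ℝ) - k - 1) * (ω * x) ^ (2 * k - 1) / (Nat.factorial (2 * k - 1) : ℝ))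

/-- The discrete function `β ↦ φ(hβ)`. -/
def sample (h : ℝ) (φ : ℝ → ℝ) : ℤ → ℝ := fun β => φ (h * β)

/-- The discrete delta function. -/
def discreteDelta : ℤ → ℝ := fun β => if β = 0 then 1 else 0

/-- `φ * ψ = χ` for discrete functions: each series `∑_γ φ(hγ) ψ(hβ - hγ)` converges absolutely,
and its sum is `χ(hβ)`. -/
def ConvolutionEq (φ ψ χ : ℤ → ℝ) : Prop :=
  ∀ β : ℤ, (Summable fun γ : ℤ => |φ γ * ψ (β - γ)|) ∧ ∑' γ : ℤ, φ γ * ψ (β - γ) = χ β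

/-- The polynomial `𝒫_{2m-2}`, with `t = hω`. -/
def polyP (m : ℕ) (t : ℝ) : ℝ[X] :=
  (1 - X) ^ (2 * m - 4) *
      (C ((2 * (m : ℝ) - 3) * Real.sin t - t * Real.cos t) * X ^ 2
        + C (2 * t - (2 * (m : ℝ) - 3) * Real.sin (2 * t)) * X
        + C ((2 * (m : ℝ) - 3) * Real.sin t - t * Real.cos t))
    + 2 * (X ^ 2 - 2 * C (Real.cos t) * X + 1) ^ 2 *
      ∑ k ∈ Icc 1 (m - 2),
        C ((-1) ^ k * ((m : ℝ) - k - 1) * t ^ (2 * k - 1) / (Nat.factorial (2 * k - 1) : ℝ))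
          * (1 - X) ^ (2 * m - 2 * k - 4) * eulerFrobenius (2 * k - 2)

/-- The coefficient `A_k` attached to a root `lam` of `𝒫_{2m-2}`. -/
def coeffA (m : ℕ) (t lam : ℝ) : ℝ :=
  (1 - lam) ^ (2 * m - 4) * (lam ^ 2 - 2 * lam * Real.cos t + 1) ^ 2
      * (polyP m t).coeff (2 * m - 2)
    / (lam * (derivative (polyP m t)).eval lam)

/-- The constant `C`. -/
def constC (m : ℕ) (t : ℝ) : ℝ :=
  4 - 4 * Real.cos t - 2 * m - (polyP m t).coeff (2 * m - 3) / (polyP m t).coeff (2 * m - 2)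

/-- The explicit discrete function built from the numbers `lam k`. -/
def explicitD (m : ℕ) (ω h : ℝ) (lam : Fin (m - 1) → ℝ) : ℤ → ℝ := fun β =>
  2 * ω ^ (2 * m - 1) / ((-1) ^ m * (polyP m (h * ω)).coeff (2 * m - 2)) *
    (if β = 0 then constC m (h * ω) + ∑ k, coeffA m (h * ω) (lam k) / lam k
     else if |β| = 1 then 1 + ∑ k, coeffA m (h * ω) (lam k)
     else ∑ k, coeffA m (h * ω) (lam k) * lam k ^ (β.natAbs - 1))

end

noncomputable section

/-! Put `t = h * ω` and regard both `G_m` on the grid and the unknown `D_m` as bi-infinite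
sequences. The generating function of the bracket of `G_m` along `t ℕ` is rational, `X 𝒫 /
annihilator` (`mk_greenBracket_mul`). Since numerator and denominator are palindromic, the even
sequence `greenSeq` satisfies `annihilator · greenSeq = 2 𝒫 · δ`, where polynomials act as centred
Laurent polynomials in the shift (`laurentAct_greenSeq`). So `D_m` has to be a constant times
`annihilator / 𝒫`, expanded on the unit circle.

That expansion needs the roots of 𝒫. Up to sign, the bracket is twice an iterated primitive of `(sin
y + y cos y) / 2`. Summing such primitives over `x + j t` with weights `z ^ j` and clearing
denominators gives functions `expSpline t k z x` with `f(0) = z f(t)`, and their values at `x = t`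
for even `k` are 𝒫 up to elementary factors (`expSpline_right_eq_polyP`). For `z < 0` a Rolle
argument on an interval with twisted ends shows that each spline has at most one zero in `[0, t)`.
Hence the end values form a Sturm chain in `k` (`expSpline_sturm`). Counting sign changes at -1 and
at 0 yields `m - 1` distinct zeros in `(-1, 0)`. Together with their reciprocals they exhaust the
degree `2m - 2`, so no root lies on the unit circle.

Partial fractions, in the form of Lagrange's formula for a leading coefficient, give a sequence
`inverseSeq` with `𝒫 · inverseSeq = δ`; applying `annihilator` to it produces the stated values,
including the exceptional ones at `|β| ≤ 1`. For uniqueness, the growth of `G_m` forces any sequence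
absolutely summable against it to be bounded. A bounded sequence may be convolved with the
exponentially decaying `inverseSeq`, and this recovers it from its convolution with `G_m`. -/

/-- The odd function in the bracket of `greenFun`. -/
def greenBracket (m : ℕ) (y : ℝ) : ℝ :=
  (2 * (m : ℝ) - 3) * Real.sin y - y * Real.cos y
    + 2 * ∑ k ∈ Icc 1 (m - 2),
        (-1) ^ k * ((m : ℝ) - k - 1) * y ^ (2 * k - 1) / (Nat.factorial (2 * k - 1) : ℝ)

/-- The characteristic polynomial of the shift operator annihilating `greenBracket` on a grid. -/
def annihilator (m : ℕ) (t : ℝ) : ℝ[X] :=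
  (1 - X) ^ (2 * m - 4) * (X ^ 2 - 2 * C (Real.cos t) * X + 1) ^ 2

/-! ### Euler–Frobenius polynomials: degree and reciprocity -/

theorem eulerFrobenius_natDegree_le (k : ℕ) : (eulerFrobenius k).natDegree ≤ k := by
  induction k with
  | zero => simp [eulerFrobenius]
  | succ k ih =>
    have h1 : (derivative (eulerFrobenius k)).natDegree ≤ k - 1 :=
      (natDegree_derivative_le _).trans (Nat.sub_le_sub_right ih 1)
    rw [eulerFrobenius]
    refine natDegree_add_le_of_degree_le ?_ ?_
    · refine natDegree_mul_le_of_le (m := 1) (n := k) ?_ ih |>.trans (by omega)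
      compute_degree
    · rcases Nat.eq_zero_or_pos k with rfl | hk
      · simp [eulerFrobenius]
      · refine natDegree_mul_le_of_le (m := 2) (n := k - 1) ?_ h1 |>.trans (by omega)
        compute_degree

theorem eulerFrobenius_eval_zero (k : ℕ) : (eulerFrobenius k).eval 0 = 1 := by
  induction k with
  | zero => simp [eulerFrobenius]
  | succ k ih => simp [eulerFrobenius, ih]

/-- Differentiate the functional equation. It serves twice: in the induction for the Euler–Frobenius
polynomials, and to compare the derivative of 𝒫 at a root and at its reciprocal. -/
theorem eval_derivative_of_selfReciprocal {p : ℝ[X]} {n : ℕ}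
    (hp : ∀ x : ℝ, x ≠ 0 → x ^ n * p.eval x⁻¹ = p.eval x) {x : ℝ} (hx : x ≠ 0) :
    x ^ n * p.derivative.eval x⁻¹
      = x * ((n : ℝ) * p.eval x - x * p.derivative.eval x) := by
  have h1 : HasDerivAt (fun y : ℝ => y ^ n * p.eval y⁻¹)
      ((n : ℝ) * x ^ (n - 1) * p.eval x⁻¹
        + x ^ n * (p.derivative.eval x⁻¹ * (-(x ^ 2)⁻¹))) x :=
    (hasDerivAt_pow n x).mul ((p.hasDerivAt x⁻¹).comp x (hasDerivAt_inv hx))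
  have h2 : HasDerivAt (fun y : ℝ => y ^ n * p.eval y⁻¹) (p.derivative.eval x) x := by
    refine (p.hasDerivAt x).congr_of_eventuallyEq ?_
    filter_upwards [isOpen_ne.mem_nhds hx] with y hy using hp y hy
  have h3 := h1.unique h2
  rw [← h3, ← hp x hx]
  rcases n with _ | n
  · simp; field_simp
  · simp only [Nat.add_sub_cancel]
    field_simp
    ring

theorem eulerFrobenius_selfReciprocal (k : ℕ) (x : ℝ) (hx : x ≠ 0) :
    x ^ k * (eulerFrobenius k).eval x⁻¹ = (eulerFrobenius k).eval x := by
  induction k generalizing x with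
  | zero => simp [eulerFrobenius]
  | succ k ih =>
    have h := eval_derivative_of_selfReciprocal ih hx
    have h' := ih x hx
    simp only [eulerFrobenius, eval_add, eval_mul, eval_one, eval_C, eval_X, eval_sub]
    have : x ^ (k + 1) * ((1 + ((k : ℝ) + 1) * x⁻¹) * (eulerFrobenius k).eval x⁻¹
          + x⁻¹ * (1 - x⁻¹) * (eulerFrobenius k).derivative.eval x⁻¹)
        = (x + (k + 1)) * (x ^ k * (eulerFrobenius k).eval x⁻¹)
          + (1 - x⁻¹) * (x ^ k * (eulerFrobenius k).derivative.eval x⁻¹) := by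
      field_simp
      ring
    rw [this, h, h']
    field_simp
    ring

/-! ### Generating functions on the grid -/

theorem mk_natCast_mul_eq (a : ℕ → ℝ) :
    PowerSeries.mk (fun n => (n : ℝ) * a n)
      = PowerSeries.X * PowerSeries.derivative ℝ (PowerSeries.mk a) := by
  ext n
  rcases n with _ | n
  · simp
  · simp [PowerSeries.coeff_succ_X_mul, PowerSeries.coeff_derivative, mul_comm]

/-- Multiplying coefficients by `n` is the operator `X d/dX`, and the recursion for `eulerFrobenius`
is exactly its effect on `X E_k / (1 - X) ^ (k + 2)`. -/
theorem mk_pow_mul_eq (k : ℕ) :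
    PowerSeries.mk (fun n => (n : ℝ) ^ (k + 1)) * ((1 - X : ℝ[X]) ^ (k + 2) : ℝ[X])
      = ((X * eulerFrobenius k : ℝ[X]) : PowerSeries ℝ) := by
  induction k with
  | zero =>
    have h : PowerSeries.mk (fun n : ℕ => (n : ℝ)) * (1 - PowerSeries.X)
        = PowerSeries.X * PowerSeries.mk (fun _ => (1 : ℝ)) := by
      ext n
      rcases n with _ | n <;> simp [mul_sub, PowerSeries.coeff_succ_mul_X,
        PowerSeries.coeff_succ_X_mul]
    have h1 : PowerSeries.mk (fun _ => (1 : ℝ)) * (1 - PowerSeries.X) = 1 :=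
      PowerSeries.mk_one_mul_one_sub_eq_one ℝ
    simp only [zero_add, pow_one, eulerFrobenius, mul_one]
    push_cast
    linear_combination (1 - PowerSeries.X) * h + PowerSeries.X * h1
  | succ k ih =>
    have h1 : PowerSeries.mk (fun n : ℕ => (n : ℝ) ^ (k + 1 + 1))
        = PowerSeries.X * PowerSeries.derivative ℝ (PowerSeries.mk fun n => (n : ℝ) ^ (k + 1)) := by
      rw [← mk_natCast_mul_eq]
      simp only [pow_succ' _ (k + 1)]
    have h2 := congrArg (PowerSeries.derivative ℝ) ih
    rw [Derivation.leibniz, PowerSeries.derivative_coe, PowerSeries.derivative_coe] at h2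
    simp only [smul_eq_mul, derivative_mul, derivative_X, derivative_pow, derivative_sub, derivative_one] at h2
    set F := PowerSeries.mk (fun n : ℕ => (n : ℝ) ^ (k + 1))
    rw [h1, eulerFrobenius]
    push_cast at h2 ih ⊢
    have h3 : (PowerSeries.C ((k : ℝ) + 2) : PowerSeries ℝ) = PowerSeries.C ((k : ℝ) + 1) + 1 := by
      rw [← map_one PowerSeries.C, ← map_add]
      congr 1
      ring
    rw [h3] at h2
    linear_combination PowerSeries.X * (1 - PowerSeries.X) * h2
      + PowerSeries.X * (PowerSeries.C ((k : ℝ) + 1) + 1) * ih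

theorem coe_two : ((2 : ℝ[X]) : PowerSeries ℝ) = 2 :=
  map_ofNat Polynomial.coeToPowerSeries.ringHom 2

/-- The three-term recurrence kills every coefficient of the product beyond the first two. -/
theorem mk_shift_mul_eq {a : ℕ → ℝ} {c : ℝ} (ha : ∀ n, a (n + 2) - 2 * c * a (n + 1) + a n = 0) :
    PowerSeries.mk a * ((X ^ 2 - 2 * C c * X + 1 : ℝ[X]) : PowerSeries ℝ)
      = ((C (a 0) + C (a 1 - 2 * c * a 0) * X : ℝ[X]) : PowerSeries ℝ) := by
  have h : PowerSeries.mk a * PowerSeries.X ^ 2 - 2 * PowerSeries.C c * (PowerSeries.mk a * PowerSeries.X)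
      + PowerSeries.mk a = PowerSeries.C (a 0) + PowerSeries.C (a 1 - 2 * c * a 0) * PowerSeries.X := by
    ext n
    have h2 : (2 : PowerSeries ℝ) * PowerSeries.C c = PowerSeries.C (2 * c) := by
      rw [map_mul, map_ofNat]
    rw [h2]
    generalize 2 * c = d at ha ⊢
    rcases n with _ | _ | n
    · simp
    · simp [PowerSeries.coeff_succ_mul_X, pow_two, ← mul_assoc]
      ring
    · have := ha n
      simp [PowerSeries.coeff_succ_mul_X, pow_two, ← mul_assoc]
      linarith
  push_cast
  rw [coe_two]
  linear_combination h

/-- The quotient rule for `X d/dX (N / D)`, with the denominator cleared; it supplies the series of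
`n cos(x + n t)`. -/
theorem mk_natCast_mul_mul_sq {a : ℕ → ℝ} {D N : ℝ[X]}
    (h : PowerSeries.mk a * (D : PowerSeries ℝ) = (N : PowerSeries ℝ)) :
    PowerSeries.mk (fun n => (n : ℝ) * a n) * ((D ^ 2 : ℝ[X]) : PowerSeries ℝ)
      = ((X * (derivative N * D - N * derivative D) : ℝ[X]) : PowerSeries ℝ) := by
  have h2 := congrArg (PowerSeries.derivative ℝ) h
  rw [Derivation.leibniz, PowerSeries.derivative_coe, PowerSeries.derivative_coe] at h2
  simp only [smul_eq_mul] at h2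
  rw [mk_natCast_mul_eq]
  push_cast
  linear_combination PowerSeries.X * (D : PowerSeries ℝ) * h2
    - PowerSeries.X * (derivative D : PowerSeries ℝ) * h

/-- The quadratic `X² - 2 cos t X + 1`. -/
def trigQuad (t : ℝ) : ℝ[X] := X ^ 2 - 2 * C (Real.cos t) * X + 1

theorem mk_sin_mul (t x : ℝ) :
    PowerSeries.mk (fun n : ℕ => Real.sin (x + n * t)) * (trigQuad t : PowerSeries ℝ)
      = ((C (Real.sin x) + C (Real.sin (t - x)) * X : ℝ[X]) : PowerSeries ℝ) := by
  have h := mk_shift_mul_eq (a := fun n : ℕ => Real.sin (x + n * t)) (c := Real.cos t) (fun n => by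
    have h1 : x + ((n + 2 : ℕ) : ℝ) * t = (x + ((n + 1 : ℕ) : ℝ) * t) + t := by push_cast; ring
    have h2 : x + (n : ℝ) * t = (x + ((n + 1 : ℕ) : ℝ) * t) - t := by push_cast; ring
    simp only [h1, h2, Real.sin_add _ t, Real.sin_sub _ t]
    ring)
  have h0 : x + ((0 : ℕ) : ℝ) * t = x := by simp
  have h1 : Real.sin (x + ((1 : ℕ) : ℝ) * t) - 2 * Real.cos t * Real.sin x = Real.sin (t - x) := by
    rw [Nat.cast_one, one_mul, Real.sin_add, Real.sin_sub]
    ring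
  rw [trigQuad, h, h0, h1]

theorem mk_cos_mul (t x : ℝ) :
    PowerSeries.mk (fun n : ℕ => Real.cos (x + n * t)) * (trigQuad t : PowerSeries ℝ)
      = ((C (Real.cos x) - C (Real.cos (t - x)) * X : ℝ[X]) : PowerSeries ℝ) := by
  have h := mk_shift_mul_eq (a := fun n : ℕ => Real.cos (x + n * t)) (c := Real.cos t) (fun n => by
    have h1 : x + ((n + 2 : ℕ) : ℝ) * t = (x + ((n + 1 : ℕ) : ℝ) * t) + t := by push_cast; ring
    have h2 : x + (n : ℝ) * t = (x + ((n + 1 : ℕ) : ℝ) * t) - t := by push_cast; ring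
    simp only [h1, h2, Real.cos_add _ t, Real.cos_sub _ t]
    ring)
  have h0 : x + ((0 : ℕ) : ℝ) * t = x := by simp
  have h1 : Real.cos (x + ((1 : ℕ) : ℝ) * t) - 2 * Real.cos t * Real.cos x = -Real.cos (t - x) := by
    rw [Nat.cast_one, one_mul, Real.cos_add, Real.cos_sub]
    ring
  rw [trigQuad, h, h0, h1, C_neg, neg_mul, ← sub_eq_add_neg]

theorem coe_finset_sum (s : Finset ℕ) (f : ℕ → ℝ[X]) :
    ((∑ k ∈ s, f k : ℝ[X]) : PowerSeries ℝ) = ∑ k ∈ s, (f k : PowerSeries ℝ) :=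
  map_sum Polynomial.coeToPowerSeries.ringHom f s

/-- The generating function of `greenBracket` on the grid `t ℕ`. -/
theorem mk_greenBracket_mul {m : ℕ} (hm : 2 ≤ m) (t : ℝ) :
    PowerSeries.mk (fun n : ℕ => greenBracket m (t * n)) * (annihilator m t : PowerSeries ℝ)
      = ((X * polyP m t : ℝ[X]) : PowerSeries ℝ) := by
  have hs := mk_sin_mul t 0
  have hc := mk_natCast_mul_mul_sq (mk_cos_mul t 0)
  have h1 : PowerSeries.mk (fun n : ℕ => greenBracket m (t * n))
      = PowerSeries.C (2 * (m : ℝ) - 3) * PowerSeries.mk (fun n : ℕ => Real.sin (0 + n * t))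
        - PowerSeries.C t * PowerSeries.mk (fun n : ℕ => (n : ℝ) * Real.cos (0 + n * t))
        + 2 * ∑ k ∈ Icc 1 (m - 2), PowerSeries.C ((-1) ^ k * ((m : ℝ) - k - 1) * t ^ (2 * k - 1)
            / (Nat.factorial (2 * k - 1) : ℝ)) * PowerSeries.mk (fun n : ℕ => (n : ℝ) ^ (2 * k - 2 + 1)) := by
    have h2 : (2 : PowerSeries ℝ) = PowerSeries.C 2 := by rw [map_ofNat]
    rw [h2]
    ext n
    simp only [greenBracket]
    generalize 2 * (m : ℝ) - 3 = a
    simp only [map_sub, map_add, map_sum, PowerSeries.coeff_C_mul, PowerSeries.coeff_mk,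
      zero_add, mul_comm (n : ℝ) t]
    congr 1
    · ring
    · congr 1
      refine Finset.sum_congr rfl fun k hk => ?_
      have : 2 * k - 2 + 1 = 2 * k - 1 := by have := (Finset.mem_Icc.mp hk).1; omega
      rw [this, mul_pow]
      ring
  have hsum : (∑ k ∈ Icc 1 (m - 2), PowerSeries.C ((-1) ^ k * ((m : ℝ) - k - 1) * t ^ (2 * k - 1)
            / (Nat.factorial (2 * k - 1) : ℝ)) * PowerSeries.mk (fun n : ℕ => (n : ℝ) ^ (2 * k - 2 + 1)))
        * (((1 - X) ^ (2 * m - 4) : ℝ[X]) : PowerSeries ℝ)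
      = PowerSeries.X * ∑ k ∈ Icc 1 (m - 2), ((C ((-1) ^ k * ((m : ℝ) - k - 1) * t ^ (2 * k - 1)
          / (Nat.factorial (2 * k - 1) : ℝ))
          * (1 - X) ^ (2 * m - 2 * k - 4) * eulerFrobenius (2 * k - 2) : ℝ[X]) : PowerSeries ℝ) := by
    rw [Finset.sum_mul, Finset.mul_sum]
    refine Finset.sum_congr rfl fun k hk => ?_
    have hk' := Finset.mem_Icc.mp hk
    have h3 := mk_pow_mul_eq (2 * k - 2)
    have h4 : 2 * m - 4 = (2 * k - 2 + 2) + (2 * m - 2 * k - 4) := by omega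
    rw [h4, pow_add]
    push_cast at h3 ⊢
    linear_combination (PowerSeries.C ((-1) ^ k * ((m : ℝ) - k - 1) * t ^ (2 * k - 1)
            / (Nat.factorial (2 * k - 1) : ℝ)) * (1 - PowerSeries.X) ^ (2 * m - 2 * k - 4)) * h3
  -- The quadratic factor of 𝒫 splits into a sine part and a cosine part by `sin 2t = 2 sin t cos
  -- t`; each is the numerator of one trigonometric series.
  have hP : polyP m t = (1 - X) ^ (2 * m - 4) *
      (C (2 * (m : ℝ) - 3) * C (Real.sin t) * trigQuad t - C t * (C (Real.cos t) * X ^ 2 - 2 * X + C (Real.cos t)))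
      + 2 * trigQuad t ^ 2 *  ∑ k ∈ Icc 1 (m - 2),
        C ((-1) ^ k * ((m : ℝ) - k - 1) * t ^ (2 * k - 1) / (Nat.factorial (2 * k - 1) : ℝ))
          * (1 - X) ^ (2 * m - 2 * k - 4) * eulerFrobenius (2 * k - 2) := by
    rw [polyP, trigQuad, Real.sin_two_mul]
    congr 1
    congr 1
    have : ((m : ℝ[X])) = C (m : ℝ) := by simp
    simp only [C_sub, C_mul, map_ofNat]
    ring
  have hcN : (X * (derivative (C (Real.cos 0) - C (Real.cos (t - 0)) * X) * trigQuad t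
      - (C (Real.cos 0) - C (Real.cos (t - 0)) * X) * derivative (trigQuad t)) : ℝ[X])
      = X * (C (Real.cos t) * X ^ 2 - 2 * X + C (Real.cos t)) := by
    simp [trigQuad]
    ring
  rw [hcN] at hc
  rw [h1, hP, annihilator, ← trigQuad]
  push_cast at hs hc hsum ⊢
  rw [coe_two, coe_finset_sum] at *
  push_cast at hs hc hsum ⊢
  simp only [Real.sin_zero, sub_zero, map_zero] at hs
  linear_combination PowerSeries.C (2 * (m : ℝ) - 3) * (1 - PowerSeries.X) ^ (2 * m - 4) * (trigQuad t : PowerSeries ℝ) * hs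
    - PowerSeries.C t * (1 - PowerSeries.X) ^ (2 * m - 4) * hc
    + 2 * (trigQuad t : PowerSeries ℝ) ^ 2 * hsum

/-! ### Reciprocity, degree and extreme coefficients of 𝒫 and of the annihilator -/

theorem pow_mul_one_sub_inv_pow {x : ℝ} (hx : x ≠ 0) (j : ℕ) :
    x ^ (2 * j) * (1 - x⁻¹) ^ (2 * j) = (1 - x) ^ (2 * j) := by
  rw [← mul_pow, pow_mul, pow_mul]
  congr 1
  field_simp
  ring

theorem polyP_selfReciprocal {m : ℕ} (hm : 2 ≤ m) (t x : ℝ) (hx : x ≠ 0) :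
    x ^ (2 * m - 2) * (polyP m t).eval x⁻¹ = (polyP m t).eval x := by
  simp only [polyP, eval_add, eval_mul, eval_pow, eval_sub, eval_one, eval_X, eval_C, eval_finsetSum,
    eval_ofNat]
  rw [mul_add]
  congr 1
  · have h1 := pow_mul_one_sub_inv_pow hx (m - 2)
    have h2 : 2 * m - 4 = 2 * (m - 2) := by omega
    have h3 : 2 * m - 2 = 2 * (m - 2) + 2 := by omega
    rw [h2, h3, ← h1, pow_add]
    field_simp
    ring
  -- For `m = 2` the subtraction `2 * m - 6` would truncate, but the sum is then empty.
  · have h3 : 2 * m - 2 = 4 + (2 * m - 6) ∨ m = 2 := by omega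
    rcases h3 with h3 | rfl
    · rw [h3, pow_add, Finset.mul_sum, Finset.mul_sum, Finset.mul_sum]
      refine Finset.sum_congr rfl fun k hk => ?_
      have hk' := Finset.mem_Icc.mp hk
      have h1 := pow_mul_one_sub_inv_pow hx (m - k - 2)
      have h2 := eulerFrobenius_selfReciprocal (2 * k - 2) x hx
      have h4 : 2 * m - 2 * k - 4 = 2 * (m - k - 2) := by omega
      have h5 : 2 * m - 6 = 2 * (m - k - 2) + (2 * k - 2) := by omega
      rw [h4, h5, ← h1, ← h2, pow_add]
      field_simp
      ring
    · simp

theorem polyP_natDegree_le {m : ℕ} (hm : 2 ≤ m) (t : ℝ) : (polyP m t).natDegree ≤ 2 * m - 2 := by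
  have hone (j : ℕ) : ((1 - X : ℝ[X]) ^ j).natDegree ≤ j := by
    refine natDegree_pow_le_of_le j (m := 1) ?_ |>.trans (by omega)
    compute_degree
  rw [polyP]
  refine natDegree_add_le_of_degree_le ?_ ?_
  · refine (natDegree_mul_le_of_le (hone _) (n := 2) ?_).trans (by omega)
    compute_degree
  · rcases Nat.lt_or_ge m 3 with h3 | h3
    · have : m = 2 := by omega
      subst this
      simp
    refine (natDegree_mul_le_of_le (m := 4) (n := 2 * m - 6) ?_ ?_).trans (by omega)
    · compute_degree
    · refine natDegree_sum_le_of_forall_le _ _ fun k hk => ?_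
      have hk' := Finset.mem_Icc.mp hk
      refine (natDegree_mul_le_of_le (natDegree_C_mul_le _ _ |>.trans (hone _))
        (eulerFrobenius_natDegree_le _)).trans (by omega)

/-- The reversed polynomial agrees with `p` at every positive real, hence equals it. -/
theorem coeff_eq_of_selfReciprocal {p : ℝ[X]} {n : ℕ} (hd : p.natDegree ≤ n)
    (hp : ∀ x : ℝ, x ≠ 0 → x ^ n * p.eval x⁻¹ = p.eval x) {i : ℕ} (hi : i ≤ n) :
    p.coeff i = p.coeff (n - i) := by
  have h : reflect n p = p := by
    refine eq_of_infinite_eval_eq _ _ ((Set.Ioi_infinite (0 : ℝ)).mono fun x hx => ?_)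
    have hx' : x ≠ 0 := (Set.mem_Ioi.mp hx).ne'
    have : Invertible x := invertibleOfNonzero hx'
    have h1 := eval₂_reflect_mul_pow (RingHom.id ℝ) x⁻¹ n p hd
    have : Invertible x⁻¹ := invertibleOfNonzero (inv_ne_zero hx')
    have h1 := eval₂_reflect_mul_pow (RingHom.id ℝ) x⁻¹ n p hd
    simp only [invOf_eq_inv, inv_inv, eval₂_id] at h1
    have h2 := hp x hx'
    simp only [Set.mem_ofPred_eq]
    rw [← h2, ← h1, inv_pow]
    field_simp
  conv_lhs => rw [← h]
  rw [coeff_reflect, revAt_le hi]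

theorem polyP_coeff_symm {m : ℕ} (hm : 2 ≤ m) (t : ℝ) {i : ℕ} (hi : i ≤ 2 * m - 2) :
    (polyP m t).coeff i = (polyP m t).coeff (2 * m - 2 - i) :=
  coeff_eq_of_selfReciprocal (polyP_natDegree_le hm t) (polyP_selfReciprocal hm t) hi

theorem polyP_eval_zero (m : ℕ) (t : ℝ) :
    (polyP m t).eval 0 = (2 * (m : ℝ) - 3) * Real.sin t - t * Real.cos t
        + 2 * ∑ k ∈ Finset.Icc 1 (m - 2),
            (-1) ^ k * ((m : ℝ) - k - 1) * t ^ (2 * k - 1) / (Nat.factorial (2 * k - 1) : ℝ) := by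
  simp [polyP, eval_finsetSum, eulerFrobenius_eval_zero]

theorem polyP_leadingCoeff_eq {m : ℕ} (hm : 2 ≤ m) (t : ℝ) :
    (polyP m t).coeff (2 * m - 2) = (polyP m t).eval 0 := by
  rw [polyP_coeff_symm hm t le_rfl, Nat.sub_self, coeff_zero_eq_eval_zero]

theorem annihilator_selfReciprocal {m : ℕ} (hm : 2 ≤ m) (t x : ℝ) (hx : x ≠ 0) :
    x ^ (2 * m) * (annihilator m t).eval x⁻¹ = (annihilator m t).eval x := by
  simp only [annihilator, eval_add, eval_mul, eval_pow, eval_sub, eval_one, eval_X, eval_C, eval_ofNat]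
  have h1 := pow_mul_one_sub_inv_pow hx (m - 2)
  have h2 : 2 * m - 4 = 2 * (m - 2) := by omega
  have h3 : 2 * m = 2 * (m - 2) + 4 := by omega
  rw [h2, ← h1]
  nth_rewrite 1 [h3]
  rw [pow_add]
  field_simp
  ring

theorem annihilator_natDegree_le {m : ℕ} (hm : 2 ≤ m) (t : ℝ) :
    (annihilator m t).natDegree ≤ 2 * m := by
  rw [annihilator]
  refine (natDegree_mul_le_of_le (m := 2 * m - 4) (n := 4) ?_ ?_).trans (by omega)
  · refine natDegree_pow_le_of_le _ (m := 1) ?_ |>.trans (by omega)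
    compute_degree
  · compute_degree

theorem annihilator_coeff_symm {m : ℕ} (hm : 2 ≤ m) (t : ℝ) {i : ℕ} (hi : i ≤ 2 * m) :
    (annihilator m t).coeff i = (annihilator m t).coeff (2 * m - i) :=
  coeff_eq_of_selfReciprocal (annihilator_natDegree_le hm t) (annihilator_selfReciprocal hm t) hi

theorem annihilator_coeff_zero (m : ℕ) (t : ℝ) : (annihilator m t).coeff 0 = 1 := by
  simp [coeff_zero_eq_eval_zero, annihilator]

theorem annihilator_coeff_one {m : ℕ} (hm : 2 ≤ m) (t : ℝ) :
    (annihilator m t).coeff 1 = 4 - 2 * m - 4 * Real.cos t := by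
  have h : (annihilator m t).coeff 1 = (derivative (annihilator m t)).coeff 0 := by
    simp [coeff_derivative]
  rw [h, coeff_zero_eq_eval_zero, annihilator]
  have : ((2 * m - 4 : ℕ) : ℝ) = 2 * m - 4 := by
    rw [Nat.cast_sub (by omega)]
    push_cast
    ring
  simp [derivative_pow, this]
  ring

/-! ### Exponential splines and their zeros -/

/-- The exponential-spline family behind `polyP`: on `[0, t]`, `expSpline t k z` is a multiple of
`∑ⱼ gₖ(x + j t) zʲ`, where `g₀(y) = (sin y + y cos y) / 2` and `gₖ₊₁` is the primitive of `gₖ`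
vanishing at `0`. -/
def expSpline (t : ℝ) : ℕ → ℝ → ℝ → ℝ
  | 0, z, x => (((trigQuad t).eval z - 2 * z * t * Real.sin t) * (Real.sin x + z * Real.sin (t - x))
      + (trigQuad t).eval z * (x * Real.cos x + z * (t - x) * Real.cos (t - x))) / 2
  | k + 1, z, x => (1 - z) * (∫ s in (0 : ℝ)..x, expSpline t k z s)
      + z * ∫ s in (0 : ℝ)..t, expSpline t k z s

theorem expSpline_continuous (t : ℝ) (k : ℕ) :
    Continuous fun p : ℝ × ℝ => expSpline t k p.1 p.2 := by
  induction k with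
  | zero =>
    have := (trigQuad t).continuous
    simp only [expSpline]
    fun_prop
  | succ k ih =>
    have h1 : Continuous fun p : ℝ × ℝ => ∫ s in (0 : ℝ)..p.2, expSpline t k p.1 s :=
      intervalIntegral.continuous_parametric_primitive_of_continuous (f := fun z s => expSpline t k z s) ih
    have h2 : Continuous fun p : ℝ × ℝ => ∫ s in (0 : ℝ)..t, expSpline t k p.1 s :=
      (h1.comp (continuous_fst.prodMk continuous_const) : Continuous fun p : ℝ × ℝ => _)
    simp only [expSpline]
    fun_prop

theorem expSpline_continuous_right (t : ℝ) (k : ℕ) (z : ℝ) : Continuous (expSpline t k z) :=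
  (expSpline_continuous t k).comp (continuous_const.prodMk continuous_id)

theorem expSpline_hasDerivAt (t : ℝ) (k : ℕ) (z x : ℝ) :
    HasDerivAt (expSpline t (k + 1) z) ((1 - z) * expSpline t k z x) x := by
  have h := (expSpline_continuous_right t k z).integral_hasStrictDerivAt 0 x
  exact (h.hasDerivAt.const_mul _).add_const _

theorem expSpline_succ_right (t : ℝ) (k : ℕ) (z : ℝ) :
    expSpline t (k + 1) z t = ∫ s in (0 : ℝ)..t, expSpline t k z s := by
  simp only [expSpline]
  ring

theorem expSpline_quasiPeriodic (t : ℝ) (k : ℕ) (z : ℝ) :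
    expSpline t k z 0 = z * expSpline t k z t := by
  rcases k with _ | k
  · simp only [expSpline]
    simp
    ring
  · rw [expSpline_succ_right]
    simp [expSpline]

/-- `f` has at most one zero in `[0, t)`. -/
def AtMostOneZero (t : ℝ) (f : ℝ → ℝ) : Prop :=
  ∀ a b, 0 ≤ a → a < b → b < t → f a = 0 → f b ≠ 0

theorem trigQuad_eval_pos {t : ℝ} (ht : 0 < t) (ht1 : t ≤ 1) (z : ℝ) : 0 < (trigQuad t).eval z := by
  have h : (trigQuad t).eval z = (z - Real.cos t) ^ 2 + Real.sin t ^ 2 := by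
    rw [Real.sin_sq]
    simp [trigQuad]
    ring
  have : 0 < Real.sin t := Real.sin_pos_of_pos_of_le_one ht ht1
  rw [h]
  positivity

theorem x_mul_sin_lt {x : ℝ} (h0 : 0 ≤ x) (h1 : x ≤ 1) : x * Real.sin x < 2 * Real.cos x := by
  rcases h0.eq_or_lt with rfl | h0'
  · simp
  have hs : Real.sin x < x := Real.sin_lt h0'
  have hc := Real.one_sub_sq_div_two_le_cos (x := x)
  nlinarith

/-- The derivative combines one positive expression, taken at `x` and at `t - x`, with weights `1/2`
and `-z/2`. Its positivity rests on `x sin x < 2 cos x`, which is where `t ≤ 1` enters. -/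
theorem expSpline_zero_strictMonoOn {t : ℝ} (ht : 0 < t) (ht1 : t ≤ 1) {z : ℝ} (hz : z < 0) :
    StrictMonoOn (expSpline t 0 z) (Set.Icc 0 t) := by
  have hQ := trigQuad_eval_pos ht ht1 z
  set Q := (trigQuad t).eval z
  have hst : 0 < Real.sin t := Real.sin_pos_of_pos_of_le_one ht ht1
  have hmono : ∀ x ∈ Set.Icc 0 t, 0 < (Q - 2 * z * t * Real.sin t) * Real.cos x
      + Q * (Real.cos x - x * Real.sin x) := by
    intro x hx
    have h1 := x_mul_sin_lt hx.1 (hx.2.trans ht1)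
    have h2 : 0 < Real.cos x := Real.cos_pos_of_le_one (by rw [abs_of_nonneg hx.1]; exact hx.2.trans ht1)
    have h3 : 0 ≤ -z * t * Real.sin t * Real.cos x := by
      have := neg_pos.mpr hz
      positivity
    nlinarith
  refine strictMonoOn_of_deriv_pos (convex_Icc 0 t) (expSpline_continuous_right t 0 z).continuousOn ?_
  intro x hx
  rw [interior_Icc] at hx
  have hx' : x ∈ Set.Icc 0 t := Set.Ioo_subset_Icc_self hx
  have hd : HasDerivAt (expSpline t 0 z)
      ((((Q - 2 * z * t * Real.sin t) * Real.cos x + Q * (Real.cos x - x * Real.sin x))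
        + (-z) * ((Q - 2 * z * t * Real.sin t) * Real.cos (t - x)
          + Q * (Real.cos (t - x) - (t - x) * Real.sin (t - x)))) / 2) x := by
    have e : HasDerivAt (fun y : ℝ => t - y) (-1) x := by simpa using (hasDerivAt_id x).const_sub t
    have e1 := e.sin
    have e2 := e.cos
    have e3 := (Real.hasDerivAt_sin x).add (e1.const_mul z)
    have e4 := ((hasDerivAt_id x).mul (Real.hasDerivAt_cos x)).add ((e.const_mul z).mul e2)
    have e5 := ((e3.const_mul (Q - 2 * z * t * Real.sin t)).add (e4.const_mul Q)).div_const 2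
    refine e5.congr_deriv ?_
    simp
    ring
  rw [hd.deriv]
  have h1 := hmono x hx'
  have h2 := hmono (t - x) ⟨by linarith [hx.2], by linarith [hx.1]⟩
  have h3 := mul_pos (neg_pos.mpr hz) h2
  linarith

/-- Rolle's theorem on an interval whose ends are glued with a negative factor. Two zeros of `f`
give a zero `x` of `g` between them. The slopes of `f` before the first zero and after the second
have equal signs, because `f 0` and `f t` have opposite signs. But `g 0` and `g t` also have
opposite signs, so `g` must vanish once more outside `x`. If `f 0 = 0`, then `f t = 0` and Rolle
applies directly on two intervals. -/
theorem AtMostOneZero.of_hasDerivAt {t z c : ℝ} (hz : z < 0) (hc : 0 < c) {f g : ℝ → ℝ}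
    (hf : ∀ x, HasDerivAt f (c * g x) x) (hgc : Continuous g) (hf0 : f 0 = z * f t) (hg0 : g 0 = z * g t)
    (hg : AtMostOneZero t g) : AtMostOneZero t f := by
  have hfc : Continuous f := continuous_iff_continuousAt.mpr fun x => (hf x).continuousAt
  have rolle : ∀ a b, a < b → f a = 0 → f b = 0 → ∃ x ∈ Set.Ioo a b, g x = 0 := by
    intro a b hab ha hb
    obtain ⟨x, hx, hx0⟩ := exists_hasDerivAt_eq_zero hab hfc.continuousOn (ha.trans hb.symm) (fun x _ => hf x)
    exact ⟨x, hx, (mul_eq_zero.mp hx0).resolve_left hc.ne'⟩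
  have mvt : ∀ a b, a < b → ∃ x ∈ Set.Ioo a b, c * g x = (f b - f a) / (b - a) := fun a b hab =>
    exists_hasDerivAt_eq_slope f _ hab hfc.continuousOn (fun x _ => hf x)
  have main : ∀ b, 0 < b → b < t → f 0 = 0 → f b ≠ 0 := by
    intro b hb hbt h0 hfb
    have hft : f t = 0 := by
      rw [h0] at hf0
      exact (mul_eq_zero.mp hf0.symm).resolve_left hz.ne
    obtain ⟨x, hx, hx0⟩ := rolle 0 b hb h0 hfb
    obtain ⟨y, hy, hy0⟩ := rolle b t hbt hfb hft
    exact hg x y hx.1.le (hx.2.trans hy.1) hy.2 hx0 hy0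
  intro a b ha hab hbt hfa hfb
  rcases eq_or_ne (f 0) 0 with h0 | h0
  · exact main b (ha.trans_lt hab) hbt h0 hfb
  have ha' : 0 < a := lt_of_le_of_ne ha fun h => h0 (h ▸ hfa)
  obtain ⟨x, hx, hx0⟩ := rolle a b hab hfa hfb
  obtain ⟨y, hy, hy0⟩ := mvt 0 a ha'
  obtain ⟨w, hw, hw0⟩ := mvt b t hbt
  -- `g` has constant sign on `[0, x)` and on `(x, t]`, against `g 0 = z * g t`
  have left : ∀ s, 0 ≤ s → s < x → g s ≠ 0 := fun s hs hsx hgs =>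
    hg s x hs hsx (hx.2.trans hbt) hgs hx0
  have right : ∀ s, x < s → s < t → g s ≠ 0 := fun s hs hst =>
    hg x s (ha.trans hx.1.le) hs hst hx0
  have hg00 : g 0 ≠ 0 := left 0 le_rfl (ha.trans_lt hx.1)
  have hgt : g t ≠ 0 := fun h => hg00 (by rw [hg0, h, mul_zero])
  have same : ∀ p q, p < q → (∀ s ∈ Set.Icc p q, g s ≠ 0) → 0 < g p * g q := by
    intro p q hpq hne
    by_contra hcon
    have hp := hne p ⟨le_rfl, hpq.le⟩
    have hq := hne q ⟨hpq.le, le_rfl⟩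
    have hlt : g p * g q < 0 := lt_of_le_of_ne (not_lt.mp hcon) (mul_ne_zero hp hq)
    have : (0 : ℝ) ∈ g '' Set.Icc p q := by
      rcases mul_neg_iff.mp hlt with ⟨h1, h2⟩ | ⟨h1, h2⟩
      · exact intermediate_value_Icc' hpq.le hgc.continuousOn ⟨h2.le, h1.le⟩
      · exact intermediate_value_Icc hpq.le hgc.continuousOn ⟨h1.le, h2.le⟩
    obtain ⟨s, hs, hs0⟩ := this
    exact hne s hs hs0
  have s1 : 0 < g 0 * g y := same 0 y hy.1 fun s hs => left s hs.1 (hs.2.trans_lt (hy.2.trans hx.1))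
  have s2 : 0 < g w * g t := same w t hw.2 fun s hs => by
    rcases hs.2.lt_or_eq with h | h
    · exact right s ((hx.2.trans hw.1).trans_le hs.1) h
    · rw [h]; exact hgt
  rw [hfa, zero_sub, sub_zero, eq_div_iff ha'.ne'] at hy0
  rw [hfb, sub_zero, eq_div_iff (sub_pos.mpr hbt).ne'] at hw0
  have k1 : g y * (c * a) = -(z * f t) := by rw [← hf0, ← hy0]; ring
  have k2 : g w * (c * (t - b)) = f t := by rw [← hw0]; ring
  rw [hg0] at s1
  have k4 : g y * (c * a) = -z * (g w * (c * (t - b))) := by rw [k1, k2]; ring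
  have p1 : 0 < c * a := mul_pos hc ha'
  have p2 : 0 < c * (t - b) := mul_pos hc (sub_pos.mpr hbt)
  have k5 : z * g t * g y * (c * a) = -z ^ 2 * (g w * g t * (c * (t - b))) := by
    linear_combination z * g t * k4
  have k6 := mul_pos s1 p1
  rw [k5] at k6
  have k7 : 0 < z ^ 2 * (g w * g t * (c * (t - b))) := mul_pos (sq_pos_of_neg hz) (mul_pos s2 p2)
  linarith

theorem expSpline_atMostOneZero {t : ℝ} (ht : 0 < t) (ht1 : t ≤ 1) {z : ℝ} (hz : z < 0) (k : ℕ) :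
    AtMostOneZero t (expSpline t k z) := by
  induction k with
  | zero =>
    intro a b ha hab hbt h1 h2
    have := expSpline_zero_strictMonoOn ht ht1 hz ⟨ha, (hab.trans hbt).le⟩ ⟨ha.trans hab.le, hbt.le⟩ hab
    rw [h1, h2] at this
    exact lt_irrefl _ this
  | succ k ih =>
    exact ih.of_hasDerivAt hz (by linarith) (expSpline_hasDerivAt t k z) (expSpline_continuous_right t k z)
      (expSpline_quasiPeriodic t (k + 1) z) (expSpline_quasiPeriodic t k z)

theorem nonneg_of_hasDerivAt_of_pos {t c : ℝ} (ht : 0 < t) (hc : 0 < c) {f g : ℝ → ℝ}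
    (hf : HasDerivAt f (c * g 0) 0) (h0 : f 0 = 0) (hpos : ∀ x ∈ Set.Ioo 0 t, 0 < f x) : 0 ≤ g 0 := by
  have h := hf.tendsto_slope_zero_right
  have : 0 ≤ c * g 0 := by
    refine ge_of_tendsto h ?_
    filter_upwards [Ioo_mem_nhdsGT ht] with x hx
    rw [zero_add, h0, sub_zero, smul_eq_mul]
    exact (mul_pos (inv_pos.mpr hx.1) (hpos x hx)).le
  exact nonneg_of_mul_nonneg_right this hc

theorem pos_or_neg_of_ne_zero {t : ℝ} {f : ℝ → ℝ} (hf : Continuous f)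
    (hne : ∀ x ∈ Set.Ioo 0 t, f x ≠ 0) :
    (∀ x ∈ Set.Ioo 0 t, 0 < f x) ∨ ∀ x ∈ Set.Ioo 0 t, f x < 0 := by
  by_contra hcon
  push Not at hcon
  obtain ⟨⟨x, hx, hfx⟩, y, hy, hfy⟩ := hcon
  obtain ⟨w, hw, hw0⟩ := isPreconnected_Ioo.intermediate_value hx hy hf.continuousOn
    ⟨hfx, hfy⟩
  exact hne w hw hw0

/-- The spline of index `k + 1` vanishes at both ends and, by uniqueness of its zero, keeps one sign
inside. Its integral, which is the end value of index `k + 2`, has that sign. So does its slope at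
0, a positive multiple of the spline of index `k` at 0; passing from 0 to `t` divides by `z < 0` and
reverses the sign. -/
theorem expSpline_sturm {t : ℝ} (ht : 0 < t) (ht1 : t ≤ 1) {z : ℝ} (hz : z < 0) {k : ℕ}
    (h : expSpline t (k + 1) z t = 0) : expSpline t k z t * expSpline t (k + 2) z t < 0 := by
  have hq := expSpline_quasiPeriodic t (k + 1) z
  rw [h, mul_zero] at hq
  have hne : ∀ x ∈ Set.Ioo 0 t, expSpline t (k + 1) z x ≠ 0 := fun x hx =>
    expSpline_atMostOneZero ht ht1 hz (k + 1) 0 x le_rfl hx.1 hx.2 hq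
  -- Rolle already gives the spline of index `k` an interior zero, so 0 cannot be a second one.
  have hk0 : expSpline t k z 0 ≠ 0 := by
    obtain ⟨x, hx, hx0⟩ := exists_hasDerivAt_eq_zero ht
      (expSpline_continuous_right t (k + 1) z).continuousOn (hq.trans h.symm)
      (fun x _ => expSpline_hasDerivAt t k z x)
    have hx0 := (mul_eq_zero.mp hx0).resolve_left (by linarith)
    exact fun h0 => expSpline_atMostOneZero ht ht1 hz k 0 x le_rfl hx.1 hx.2 h0 hx0
  have hc : 0 < 1 - z := by linarith
  have hd := expSpline_hasDerivAt t k z 0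
  have hk1 : expSpline t k z 0 = z * expSpline t k z t := expSpline_quasiPeriodic t k z
  have hcont := expSpline_continuous_right t (k + 1) z
  rw [expSpline_succ_right t (k + 1)]
  rcases pos_or_neg_of_ne_zero hcont hne with hp | hn
  · have h1 := nonneg_of_hasDerivAt_of_pos ht hc hd hq hp
    have h2 : 0 < expSpline t k z 0 := lt_of_le_of_ne h1 hk0.symm
    have h3 := intervalIntegral.intervalIntegral_pos_of_pos_on (hcont.intervalIntegrable 0 t)
      (fun x hx => hp x hx) ht
    rw [hk1] at h2
    exact mul_neg_of_neg_of_pos (neg_of_mul_pos_right h2 hz.le) h3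
  · have h1 := nonneg_of_hasDerivAt_of_pos (f := fun x => -expSpline t (k + 1) z x)
      (g := fun x => -expSpline t k z x) ht hc (by rw [mul_neg]; exact hd.neg)
      (by rw [hq, neg_zero]) (fun x hx => neg_pos.mpr (hn x hx))
    have h2 : expSpline t k z 0 < 0 := lt_of_le_of_ne (neg_nonneg.mp h1) hk0
    have h3 := intervalIntegral.intervalIntegral_pos_of_pos_on (hcont.neg.intervalIntegrable 0 t)
      (fun x hx => neg_pos.mpr (hn x hx)) ht
    simp only [Pi.neg_apply, intervalIntegral.integral_neg, neg_pos] at h3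
    rw [hk1] at h2
    exact mul_neg_of_pos_of_neg (pos_of_mul_neg_right h2 hz.le) h3

theorem expSpline_zero_right_pos {t : ℝ} (ht : 0 < t) (ht1 : t ≤ 1) {z : ℝ} (hz : z ≤ 0) :
    0 < expSpline t 0 z t := by
  have hQ := trigQuad_eval_pos ht ht1 z
  have hst : 0 < Real.sin t := Real.sin_pos_of_pos_of_le_one ht ht1
  have hct : 0 < Real.cos t := Real.cos_pos_of_le_one (by rwa [abs_of_pos ht])
  simp only [expSpline, sub_self, Real.sin_zero, mul_zero, zero_mul, add_zero]
  have : 0 ≤ -z * t * Real.sin t := by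
    have := neg_nonneg.mpr hz
    positivity
  have h1 : 0 < (trigQuad t).eval z - 2 * z * t * Real.sin t := by linarith
  positivity

theorem expSpline_at_zero_pos {t : ℝ} (ht1 : t ≤ 1) (k : ℕ) :
    ∀ x ∈ Set.Ioc 0 t, 0 < expSpline t k 0 x := by
  induction k with
  | zero =>
    intro x hx
    have hst : 0 < Real.sin x := Real.sin_pos_of_pos_of_le_one hx.1 (hx.2.trans ht1)
    have hct : 0 < Real.cos x := Real.cos_pos_of_le_one (by
      rw [abs_of_pos hx.1]; exact hx.2.trans ht1)
    have hx0 := hx.1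
    simp [expSpline, trigQuad]
    positivity
  | succ k ih =>
    intro x hx
    simp only [expSpline, sub_zero, one_mul, zero_mul, add_zero]
    exact intervalIntegral.intervalIntegral_pos_of_pos_on
      ((expSpline_continuous_right t k 0).intervalIntegrable 0 x)
      (fun y hy => ih y ⟨hy.1, hy.2.le.trans hx.2⟩) hx.1

theorem expSpline_neg_one_symm (t : ℝ) (k : ℕ) (x : ℝ) :
    expSpline t k (-1) (t - x) = (-1) ^ (k + 1) * expSpline t k (-1) x := by
  induction k generalizing x with
  | zero => simp [expSpline]; ring
  | succ k ih =>
    have hi : ∀ a b, IntervalIntegrable (expSpline t k (-1)) MeasureTheory.volume a b :=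
      fun a b => (expSpline_continuous_right t k (-1)).intervalIntegrable a b
    have h1 : ∫ s in (t - x)..t, expSpline t k (-1) s
        = (-1) ^ (k + 1) * ∫ s in (0 : ℝ)..x, expSpline t k (-1) s := by
      rw [← intervalIntegral.integral_const_mul]
      simp_rw [← ih]
      rw [intervalIntegral.integral_comp_sub_left (fun s => expSpline t k (-1) s) t, sub_zero]
    have h2 : ∫ s in (0 : ℝ)..t, expSpline t k (-1) s
        = (-1) ^ (k + 1) * ∫ s in (0 : ℝ)..t, expSpline t k (-1) s := by
      rw [← intervalIntegral.integral_const_mul]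
      simp_rw [← ih]
      rw [intervalIntegral.integral_comp_sub_left (fun s => expSpline t k (-1) s) t, sub_zero, sub_self]
    have h3 := intervalIntegral.integral_add_adjacent_intervals (hi 0 (t - x)) (hi (t - x) t)
    simp only [expSpline]
    rw [pow_succ (-1 : ℝ) (k + 1)]
    rw [h1] at h3
    rcases neg_one_pow_eq_or ℝ (k + 1) with h | h <;> rw [h] at h2 h3 ⊢ <;> linarith

/-- For odd index and `z = -1` the reflection `x ↦ t - x` makes the end values equal, while
quasi-periodicity makes them opposite. -/
theorem expSpline_neg_one_odd (t : ℝ) (j : ℕ) : expSpline t (2 * j + 1) (-1) t = 0 := by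
  have h1 := expSpline_neg_one_symm t (2 * j + 1) 0
  have h2 := expSpline_quasiPeriodic t (2 * j + 1) (-1)
  rw [sub_zero, h2] at h1
  have : (-1 : ℝ) ^ (2 * j + 1 + 1) = 1 := Even.neg_one_pow ⟨j + 1, by ring⟩
  rw [this] at h1
  linarith

/-! ### Sturm counting of sign changes -/

/-- The number of sign changes in `R 0 z, …, R k z`, where `0` counts as negative. -/
def signChanges (R : ℕ → ℝ → ℝ) (k : ℕ) (z : ℝ) : ℕ :=
  ∑ i ∈ range k, if (0 < R i z ↔ 0 < R (i + 1) z) then 0 else 1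

theorem signChanges_succ (R : ℕ → ℝ → ℝ) (k : ℕ) (z : ℝ) :
    signChanges R (k + 1) z
      = signChanges R k z + if (0 < R k z ↔ 0 < R (k + 1) z) then 0 else 1 :=
  sum_range_succ _ _

theorem eventually_pos_iff {f : ℝ → ℝ} (hf : Continuous f) {z : ℝ} (hz : f z ≠ 0) :
    ∀ᶠ w in nhds z, (0 < f w ↔ 0 < f z) := by
  rcases hz.lt_or_gt with h | h
  · filter_upwards [hf.continuousAt.eventually_lt_const h] with w hw
    exact ⟨fun h' => absurd h' hw.not_gt, fun h' => absurd h' h.not_gt⟩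
  · filter_upwards [hf.continuousAt.eventually_const_lt h] with w hw
    exact ⟨fun _ => h, fun _ => hw⟩

theorem pos_iff_not_pos_of_mul_neg {a b : ℝ} (h : a * b < 0) : 0 < a ↔ ¬ 0 < b := by
  rcases mul_neg_iff.mp h with ⟨h1, h2⟩ | ⟨h1, h2⟩
  · exact ⟨fun _ => h2.not_gt, fun _ => h1⟩
  · exact ⟨fun h => absurd h h1.not_gt, fun h => absurd h2 h⟩

/-- Where an intermediate member vanishes its neighbours have opposite signs, so the triple
contributes exactly one change whatever sign the middle takes nearby. The induction therefore steps
over such a member by two. -/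
theorem signChanges_eventually_eq {R : ℕ → ℝ → ℝ} (hR : ∀ k, Continuous (R k)) {z : ℝ}
    (h0 : R 0 z ≠ 0) (hst : ∀ k, R (k + 1) z = 0 → R k z * R (k + 2) z < 0) (k : ℕ) :
    R k z ≠ 0 → ∀ᶠ w in nhds z, signChanges R k w = signChanges R k z := by
  have step : ∀ k, R k z ≠ 0 → R (k + 1) z ≠ 0 →
      (∀ᶠ w in nhds z, signChanges R k w = signChanges R k z) →
      ∀ᶠ w in nhds z, signChanges R (k + 1) w = signChanges R (k + 1) z := by
    intro k h1 h2 h3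
    filter_upwards [eventually_pos_iff (hR k) h1, eventually_pos_iff (hR (k + 1)) h2, h3] with w a b c
    simp only [signChanges_succ, a, b, c]
  induction k using Nat.strong_induction_on with
  | _ k ih =>
    intro hk
    rcases k with _ | _ | k
    · exact Filter.Eventually.of_forall fun w => by simp [signChanges]
    · exact step 0 h0 hk (ih 0 (by omega) h0)
    · by_cases h1 : R (k + 1) z = 0
      · have h2 := hst k h1
        have h3 : R k z ≠ 0 := left_ne_zero_of_mul h2.ne
        have key : ∀ w, (0 < R k w ↔ ¬ 0 < R (k + 2) w) →
            signChanges R (k + 2) w = signChanges R k w + 1 := by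
          intro w hw
          simp only [signChanges_succ, add_assoc, hw]
          by_cases a : 0 < R (k + 1) w <;> by_cases b : 0 < R (k + 2) w <;> simp [a, b]
        have h4 := pos_iff_not_pos_of_mul_neg h2
        filter_upwards [eventually_pos_iff (hR k) h3, eventually_pos_iff (hR (k + 2)) hk,
          ih k (by omega) h3] with w a b c
        rw [key z h4, key w (by rw [a, b, h4]), c]
      · exact step (k + 1) h1 hk (ih (k + 1) (by omega) h1)

/-- At a zero of the last member only the last summand can vary, so the count jumps by at most one.
-/
theorem signChanges_eventually_mem {R : ℕ → ℝ → ℝ} (hR : ∀ k, Continuous (R k)) {z : ℝ}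
    (h0 : R 0 z ≠ 0) (hst : ∀ k, R (k + 1) z = 0 → R k z * R (k + 2) z < 0) (k : ℕ) :
    ∃ d, ∀ᶠ w in nhds z, d ≤ signChanges R k w ∧ signChanges R k w ≤ d + 1 := by
  by_cases hk : R k z = 0
  · obtain ⟨k, rfl⟩ : ∃ j, k = j + 1 := Nat.exists_eq_succ_of_ne_zero fun h => h0 (h ▸ hk)
    refine ⟨signChanges R k z, ?_⟩
    filter_upwards [signChanges_eventually_eq hR h0 hst k (left_ne_zero_of_mul (hst k hk).ne)] with w hw
    rw [signChanges_succ, hw]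
    split_ifs <;> omega
  · refine ⟨signChanges R k z, ?_⟩
    filter_upwards [signChanges_eventually_eq hR h0 hst k hk] with w hw
    omega

/-- Zeros of the last member of a Sturm chain on `[-1, 0]`. -/
theorem exists_zeros_of_sturm {R : ℕ → ℝ → ℝ} (hR : ∀ k, Continuous (R k))
    (h0 : ∀ z ∈ Set.Icc (-1 : ℝ) 0, 0 < R 0 z)
    (hst : ∀ z ∈ Set.Ico (-1 : ℝ) 0, ∀ k, R (k + 1) z = 0 → R k z * R (k + 2) z < 0)
    (hzero : ∀ k, 0 < R k 0) (hodd : ∀ j, R (2 * j + 1) (-1) = 0) (n : ℕ) :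
    ∃ lam : Fin n → ℝ, Function.Injective lam ∧ ∀ i, lam i ∈ Set.Ioo (-1 : ℝ) 0 ∧ R (2 * n) (lam i) = 0 := by
  have hst' : ∀ z ∈ Set.Icc (-1 : ℝ) 0, ∀ k, R (k + 1) z = 0 → R k z * R (k + 2) z < 0 := by
    intro z hz k hk
    rcases hz.2.lt_or_eq with h | rfl
    · exact hst z ⟨hz.1, h⟩ k hk
    · exact absurd hk (hzero _).ne'
  have hm1 : (-1 : ℝ) ∈ Set.Icc (-1 : ℝ) 0 := by norm_num
  have hm0 : (0 : ℝ) ∈ Set.Icc (-1 : ℝ) 0 := by norm_num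
  have heven : ∀ j, R (2 * j) (-1) ≠ 0 := fun j =>
    left_ne_zero_of_mul (hst' (-1) hm1 (2 * j) (hodd j)).ne
  -- At -1 the odd members vanish and the even ones alternate in sign: one change for every two
  -- steps.
  have hv1 : ∀ j, signChanges R (2 * j) (-1) = j := by
    intro j
    induction j with
    | zero => simp [signChanges]
    | succ j ih =>
      have h := pos_iff_not_pos_of_mul_neg (hst' (-1) hm1 (2 * j) (hodd j))
      rw [show 2 * (j + 1) = 2 * j + 1 + 1 by ring, signChanges_succ, signChanges_succ, ih, hodd j]
      simp only [h]
      by_cases b : 0 < R (2 * j + 2) (-1) <;> simp [b]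
  have hv0 : ∀ k, signChanges R k 0 = 0 := fun k => by simp [signChanges, hzero]
  set v := signChanges R (2 * n) with hv
  have hloc : ∀ z ∈ Set.Icc (-1 : ℝ) 0, R (2 * n) z ≠ 0 → ∀ᶠ w in nhds z, v w = v z :=
    fun z hz => signChanges_eventually_eq hR (h0 z hz).ne' (hst' z hz) (2 * n)
  let S : Fin n → Set ℝ := fun i => {z | z ∈ Set.Icc (-1 : ℝ) 0 ∧ i.1 + 1 ≤ v z}
  have hSne : ∀ i, (-1 : ℝ) ∈ S i := fun i => ⟨hm1, by rw [hv, hv1]; exact i.2⟩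
  have hSb : ∀ i, BddAbove (S i) := fun i => ⟨0, fun z hz => hz.1.2⟩
  -- The count falls from `n` at -1 to 0 at 0; `lam i` is the last place where it is at least `i +
  -- 1`.
  let lam : Fin n → ℝ := fun i => sSup (S i)
  have hfreq : ∀ i, ∃ᶠ w in nhds (lam i), i.1 + 1 ≤ v w := fun i =>
    (mem_closure_iff_frequently.mp (csSup_mem_closure ⟨_, hSne i⟩ (hSb i))).mono fun w hw => hw.2
  have hlow : ∀ i, -1 < lam i := by
    intro i
    have h1 := hloc (-1) hm1 (heven n)
    have h2 : ∃ᶠ w in nhdsWithin (-1 : ℝ) (Set.Ioi (-1)), w ∈ Set.Ioo (-1 : ℝ) 0 :=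
      (Filter.Eventually.frequently (Ioo_mem_nhdsGT (by norm_num)))
    obtain ⟨w, hw, hw'⟩ := (h2.and_eventually (h1.filter_mono nhdsWithin_le_nhds)).exists
    have : w ∈ S i := ⟨⟨hw.1.le, hw.2.le⟩, by rw [hw', hv, hv1]; exact i.2⟩
    exact hw.1.trans_le (le_csSup (hSb i) this)
  have hup : ∀ i, lam i < 0 := by
    intro i
    have h3 : lam i ≤ 0 := csSup_le ⟨_, hSne i⟩ fun z hz => hz.1.2
    refine lt_of_le_of_ne h3 fun h => ?_
    have h1 := hloc 0 hm0 (hzero _).ne'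
    have h2 := hfreq i
    rw [h] at h2
    obtain ⟨w, hw, hw'⟩ := (h2.and_eventually h1).exists
    rw [hw', hv, hv0] at hw
    omega
  have hmem : ∀ i, lam i ∈ Set.Icc (-1 : ℝ) 0 := fun i => ⟨(hlow i).le, (hup i).le⟩
  have hright : ∀ i, ∃ᶠ w in nhds (lam i), v w < i.1 + 1 := by
    intro i
    have h2 : ∃ᶠ w in nhdsWithin (lam i) (Set.Ioi (lam i)), w ∈ Set.Ioo (lam i) 0 :=
      Filter.Eventually.frequently (Ioo_mem_nhdsGT (hup i))
    refine (h2.filter_mono nhdsWithin_le_nhds).mono fun w hw => ?_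
    by_contra hcon
    exact absurd (le_csSup (hSb i) ⟨⟨(hlow i).le.trans hw.1.le, hw.2.le⟩, not_lt.mp hcon⟩) hw.1.not_ge
  refine ⟨lam, ?_, fun i => ⟨⟨hlow i, hup i⟩, ?_⟩⟩
  -- A coincidence would give nearby counts at most `i` and at least `j + 1 ≥ i + 2`, a jump of two
  -- at one point.
  · have hlt : ∀ i j : Fin n, i < j → lam i ≠ lam j := by
      intro i j hij h
      obtain ⟨d, hd⟩ := signChanges_eventually_mem hR (h0 _ (hmem i)).ne' (hst' _ (hmem i)) (2 * n)
      rw [← hv] at hd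
      obtain ⟨w, hw, hw'⟩ := ((hright i).and_eventually hd).exists
      rw [h] at hd
      obtain ⟨u, hu, hu'⟩ := ((hfreq j).and_eventually hd).exists
      have : i.1 < j.1 := hij
      omega
    intro i j h
    rcases lt_trichotomy i j with h' | h' | h'
    · exact absurd h (hlt i j h')
    · exact h'
    · exact absurd h.symm (hlt j i h')
  · by_contra hne
    have h1 := hloc _ (hmem i) hne
    obtain ⟨w, hw, hw'⟩ := ((hright i).and_eventually h1).exists
    obtain ⟨u, hu, hu'⟩ := ((hfreq i).and_eventually h1).exists
    omega

theorem exists_zeros_expSpline {t : ℝ} (ht : 0 < t) (ht1 : t ≤ 1) (n : ℕ) :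
    ∃ lam : Fin n → ℝ, Function.Injective lam ∧
      ∀ i, lam i ∈ Set.Ioo (-1 : ℝ) 0 ∧ expSpline t (2 * n) (lam i) t = 0 :=
  exists_zeros_of_sturm (R := fun k z => expSpline t k z t)
    (fun k => (expSpline_continuous t k).comp (continuous_id.prodMk continuous_const))
    (fun _ hz => expSpline_zero_right_pos ht ht1 hz.2)
    (fun _ hz _ h => expSpline_sturm ht ht1 hz.2 h)
    (fun k => expSpline_at_zero_pos ht1 k t ⟨ht, le_rfl⟩)
    (fun j => expSpline_neg_one_odd t j) n

/-! ### Power series of the iterated primitives -/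

/-- The iterated primitives, vanishing at `0`, of `(sin y + y cos y) / 2`. -/
def iterKernel : ℕ → ℝ → ℝ
  | 0, y => (Real.sin y + y * Real.cos y) / 2
  | k + 1, y => ∫ s in (0 : ℝ)..y, iterKernel k s

theorem iterKernel_continuous (k : ℕ) : Continuous (iterKernel k) := by
  induction k with
  | zero => simp only [iterKernel]; fun_prop
  | succ k ih =>
    simp only [iterKernel]
    exact intervalIntegral.continuous_primitive (fun a b => ih.intervalIntegrable a b) 0

theorem iterKernel_zero_right (k : ℕ) : iterKernel k 0 = 0 := by
  cases k <;> simp [iterKernel]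

/-- A crude polynomial bound suffices: it gives convergence of the series for `|z| < 1`, and later
bounds `greenSeq`. -/
theorem abs_iterKernel_le (k : ℕ) {y : ℝ} (hy : 0 ≤ y) : |iterKernel k y| ≤ (1 + y) ^ (k + 1) := by
  induction k generalizing y with
  | zero =>
    have h1 := Real.abs_sin_le_one y
    have h2 := Real.abs_cos_le_one y
    have h3 : |y * Real.cos y| ≤ y := by
      rw [abs_mul, abs_of_nonneg hy]
      exact mul_le_of_le_one_right hy h2
    have h4 := abs_add_le (Real.sin y) (y * Real.cos y)
    simp only [iterKernel, zero_add, pow_one, abs_div, abs_two]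
    linarith
  | succ k ih =>
    have h := intervalIntegral.norm_integral_le_of_norm_le_const (a := 0) (b := y)
      (f := iterKernel k) (C := (1 + y) ^ (k + 1)) (fun s hs => by
        rw [Set.uIoc_of_le hy] at hs
        refine (ih hs.1.le).trans ?_
        have := hs.1
        have := hs.2
        gcongr)
    rw [Real.norm_eq_abs, sub_zero, abs_of_nonneg hy] at h
    simp only [iterKernel]
    refine h.trans ?_
    rw [pow_succ _ (k + 1)]
    gcongr
    linarith

theorem summable_pow_mul_abs_pow {z : ℝ} (hz : |z| < 1) {c t : ℝ} (hc : 0 ≤ c) (ht : 0 ≤ t) (k : ℕ) :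
    Summable fun j : ℕ => (1 + (c + j * t)) ^ k * |z| ^ j := by
  rcases eq_or_ne z 0 with rfl | hz0
  · refine summable_of_ne_finset_zero (s := {0}) fun j hj => ?_
    have : j ≠ 0 := by simpa using hj
    simp [this]
  have h1 := (summable_nat_add_iff 1).mpr (summable_pow_mul_geometric_of_norm_lt_one k
    (r := |z|) (by rwa [Real.norm_eq_abs, abs_abs]))
  refine Summable.of_nonneg_of_le (fun j => by positivity) (fun j => ?_)
    (h1.mul_left ((1 + c + t) ^ k * |z|⁻¹))
  have h2 : (1 + (c + j * t)) ^ k ≤ ((1 + c + t) * (j + 1)) ^ k := by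
    have : (0 : ℝ) ≤ j := j.cast_nonneg
    gcongr
    nlinarith [mul_nonneg hc this]
  have h3 : |z| ≠ 0 := abs_ne_zero.mpr hz0
  calc (1 + (c + j * t)) ^ k * |z| ^ j ≤ ((1 + c + t) * (j + 1)) ^ k * |z| ^ j := by gcongr
    _ = (1 + c + t) ^ k * |z|⁻¹ * (((j + 1 : ℕ) : ℝ) ^ k * |z| ^ (j + 1)) := by
      rw [mul_pow, pow_succ]
      push_cast
      field_simp

theorem norm_iterKernel_mul_le {z t x c : ℝ} (ht : 0 ≤ t) (hx : 0 ≤ x) (hxc : x ≤ c) (k j : ℕ) :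
    ‖iterKernel k (x + j * t) * z ^ j‖ ≤ (1 + (c + j * t)) ^ (k + 1) * |z| ^ j := by
  rw [norm_mul, norm_pow, Real.norm_eq_abs, Real.norm_eq_abs]
  have h := abs_iterKernel_le k (y := x + j * t) (by positivity)
  refine mul_le_mul_of_nonneg_right (h.trans ?_) (by positivity)
  gcongr

theorem summable_norm_iterKernel {z : ℝ} (hz : |z| < 1) {x t : ℝ} (hx : 0 ≤ x) (ht : 0 ≤ t) (k : ℕ) :
    Summable fun j : ℕ => ‖iterKernel k (x + j * t) * z ^ j‖ :=
  Summable.of_nonneg_of_le (fun _ => norm_nonneg _) (fun j => norm_iterKernel_mul_le ht hx le_rfl k j)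
    (summable_pow_mul_abs_pow hz hx ht (k + 1))

/-- The exponential series of `iterKernel k`. -/
def kernelSeries (t : ℝ) (k : ℕ) (z x : ℝ) : ℝ := ∑' j : ℕ, iterKernel k (x + j * t) * z ^ j

theorem integral_kernelSeries {z : ℝ} (hz : |z| < 1) {x t : ℝ} (hx : 0 ≤ x) (ht : 0 ≤ t) (k : ℕ) :
    ∫ s in (0 : ℝ)..x, kernelSeries t k z s = kernelSeries t (k + 1) z x - kernelSeries t (k + 1) z 0 := by
  let f : ℕ → C(ℝ, ℝ) := fun j => ⟨fun s => iterKernel k (s + j * t) * z ^ j,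
    ((iterKernel_continuous k).comp (continuous_id.add continuous_const)).mul continuous_const⟩
  have hf : Summable fun j => ‖(f j).restrict (⟨Set.uIcc 0 x, isCompact_uIcc⟩ : TopologicalSpace.Compacts ℝ)‖ := by
    refine Summable.of_nonneg_of_le (fun _ => norm_nonneg _) (fun j => ?_)
      (summable_pow_mul_abs_pow hz hx ht (k + 1))
    rw [ContinuousMap.norm_le _ (by positivity)]
    intro s
    have hs : s.1 ∈ Set.Icc 0 x := Set.uIcc_of_le hx ▸ (show s.1 ∈ Set.uIcc 0 x from s.2)
    exact norm_iterKernel_mul_le ht hs.1 hs.2 k j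
  have h := intervalIntegral.hasSum_intervalIntegral_of_summable_norm hf
  have h1 : ∀ j : ℕ, ∫ s in (0 : ℝ)..x, f j s
      = iterKernel (k + 1) (x + j * t) * z ^ j - iterKernel (k + 1) (0 + j * t) * z ^ j := by
    intro j
    change ∫ s in (0 : ℝ)..x, iterKernel k (s + j * t) * z ^ j = _
    rw [intervalIntegral.integral_mul_const, intervalIntegral.integral_comp_add_right, ← sub_mul]
    congr 1
    simp only [iterKernel]
    rw [intervalIntegral.integral_interval_sub_left] <;>
      exact (iterKernel_continuous k).intervalIntegrable _ _
  simp_rw [h1] at h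
  rw [kernelSeries.eq_1 t (k + 1), kernelSeries.eq_1 t (k + 1),
    ← (summable_norm_iterKernel hz hx ht (k + 1)).of_norm.tsum_sub
      (summable_norm_iterKernel hz le_rfl ht (k + 1)).of_norm]
  exact h.tsum_eq.symm

/-- An index shift; the term `j = 0` drops out because every kernel vanishes at 0. -/
theorem kernelSeries_zero_right {z : ℝ} (hz : |z| < 1) {t : ℝ} (ht : 0 ≤ t) (k : ℕ) :
    kernelSeries t k z 0 = z * kernelSeries t k z t := by
  rw [kernelSeries, (summable_norm_iterKernel hz le_rfl ht k).of_norm.tsum_eq_zero_add, kernelSeries,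
    ← tsum_mul_left]
  simp only [Nat.cast_zero, zero_mul, add_zero, iterKernel_zero_right, zero_add]
  refine tsum_congr fun j => ?_
  rw [show ((j + 1 : ℕ) : ℝ) * t = t + j * t by push_cast; ring]
  ring

/-- Turns a formal identity into a numerical one by the Cauchy product. -/
theorem eval_mul_tsum_of_mk_mul {a : ℕ → ℝ} {D N : ℝ[X]}
    (h : PowerSeries.mk a * (D : PowerSeries ℝ) = (N : PowerSeries ℝ)) {z : ℝ}
    (ha : Summable fun n => ‖a n * z ^ n‖) : (∑' n, a n * z ^ n) * D.eval z = N.eval z := by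
  have hsupp (p : ℝ[X]) : ∀ n : ℕ, n ∉ range (p.natDegree + 1) → p.coeff n * z ^ n = 0 := by
    intro n hn
    rw [Finset.mem_range] at hn
    rw [coeff_eq_zero_of_natDegree_lt (by omega), zero_mul]
  have heval (p : ℝ[X]) : p.eval z = ∑' n, p.coeff n * z ^ n := by
    rw [tsum_eq_sum (hsupp p), eval_eq_sum_range]
  have hD : Summable fun n => ‖D.coeff n * z ^ n‖ := by
    refine summable_of_ne_finset_zero (s := range (D.natDegree + 1)) fun n hn => ?_
    rw [hsupp D n hn, norm_zero]
  rw [heval D, heval N, tsum_mul_tsum_eq_tsum_sum_antidiagonal_of_summable_norm ha hD]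
  refine tsum_congr fun n => ?_
  have hn := congrArg (PowerSeries.coeff n) h
  rw [PowerSeries.coeff_mul, Polynomial.coeff_coe] at hn
  rw [← hn, Finset.sum_mul]
  refine Finset.sum_congr rfl fun p hp => ?_
  rw [PowerSeries.coeff_mk, Polynomial.coeff_coe, ← Finset.HasAntidiagonal.mem_antidiagonal.mp hp, pow_add]
  ring

theorem summable_norm_of_abs_le {z : ℝ} (hz : |z| < 1) {a : ℕ → ℝ} {k : ℕ}
    (ha : ∀ n : ℕ, |a n| ≤ (1 + (0 + n * 1)) ^ k) : Summable fun n => ‖a n * z ^ n‖ := by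
  refine Summable.of_nonneg_of_le (fun _ => norm_nonneg _) (fun n => ?_)
    (summable_pow_mul_abs_pow hz le_rfl zero_le_one k)
  rw [norm_mul, norm_pow, Real.norm_eq_abs, Real.norm_eq_abs]
  exact mul_le_mul_of_nonneg_right (ha n) (by positivity)

theorem expSpline_zero_eq {z : ℝ} (hz : |z| < 1) (t x : ℝ) :
    expSpline t 0 z x = (trigQuad t).eval z ^ 2 * kernelSeries t 0 z x := by
  have b1 : ∀ y : ℕ → ℝ, Summable fun n : ℕ => ‖Real.sin (y n) * z ^ n‖ := fun y =>
    summable_norm_of_abs_le (k := 0) hz fun n => by simpa using Real.abs_sin_le_one _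
  have b2 : ∀ y : ℕ → ℝ, Summable fun n : ℕ => ‖Real.cos (y n) * z ^ n‖ := fun y =>
    summable_norm_of_abs_le (k := 0) hz fun n => by simpa using Real.abs_cos_le_one _
  have b3 : ∀ y : ℕ → ℝ, Summable fun n : ℕ => ‖(n * Real.cos (y n)) * z ^ n‖ := fun y =>
    summable_norm_of_abs_le (k := 1) hz fun n => by
      rw [abs_mul, Nat.abs_cast]
      have := Real.abs_cos_le_one (y n)
      have hn : (0 : ℝ) ≤ n := n.cast_nonneg
      nlinarith
  have h1 := eval_mul_tsum_of_mk_mul (mk_sin_mul t x) (b1 _)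
  have h2 := eval_mul_tsum_of_mk_mul (mk_cos_mul t x) (b2 _)
  have h3 := eval_mul_tsum_of_mk_mul (mk_natCast_mul_mul_sq (mk_cos_mul t x)) (b3 _)
  have h4 : kernelSeries t 0 z x = (1 / 2) * (∑' n : ℕ, Real.sin (x + n * t) * z ^ n)
      + (x / 2) * (∑' n : ℕ, Real.cos (x + n * t) * z ^ n)
      + (t / 2) * ∑' n : ℕ, (n * Real.cos (x + n * t)) * z ^ n := by
    rw [← tsum_mul_left, ← tsum_mul_left, ← tsum_mul_left,
      ← ((b1 _).of_norm.mul_left _).tsum_add ((b2 _).of_norm.mul_left _),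
      ← (((b1 _).of_norm.mul_left _).add ((b2 _).of_norm.mul_left _)).tsum_add ((b3 _).of_norm.mul_left _)]
    refine tsum_congr fun j => ?_
    simp only [iterKernel]
    ring
  rw [h4]
  generalize ∑' n : ℕ, Real.sin (x + n * t) * z ^ n = A at *
  generalize ∑' n : ℕ, Real.cos (x + n * t) * z ^ n = B at *
  generalize ∑' n : ℕ, (n * Real.cos (x + n * t)) * z ^ n = B' at *
  simp only [expSpline]
  have hd : derivative (trigQuad t) = 2 * X - 2 * C (Real.cos t) := by
    simp [trigQuad, one_add_one_eq_two, map_ofNat C 2]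
  simp only [eval_mul, eval_X, eval_sub, eval_add, eval_C, eval_pow, derivative_sub, derivative_mul, derivative_C,
    derivative_X, hd, eval_ofNat, zero_mul, zero_add, mul_one, zero_sub, eval_neg] at h1 h2 h3
  have hQ : (trigQuad t).eval z = z ^ 2 - 2 * Real.cos t * z + 1 := by simp [trigQuad]
  set Q := (trigQuad t).eval z
  have hs := Real.sin_sub t x
  have hc := Real.cos_sub t x
  have hsq := Real.sin_sq_add_cos_sq t
  -- Rewrites the quotient-rule numerator `N' Q - N Q'` of the cosine series as `Q cos(t - x)` minus
  -- `2 sin t` times the sine numerator; this is the origin of the shape of `expSpline t 0`.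
  have key : -2 * Q * Real.cos (t - x) - (Real.cos x - z * Real.cos (t - x)) * (2 * z - 2 * Real.cos t)
      = -2 * Real.sin t * (Real.sin x + z * Real.sin (t - x)) := by
    rw [hQ, hs, hc]
    linear_combination (2 * z * Real.cos x) * hsq
  linear_combination (-Q / 2) * h1 - (x * Q / 2) * h2 - (t / 2) * h3 - (z * t / 2) * key

/-- Termwise integration produces `S(x) - S(0)` and `S(t) - S(0)`. With weights `1 - z` and `z`, the
constants cancel by `S(0) = z S(t)` and leave `(1 - z) S(x)`, which explains the recursion for
`expSpline`. -/
theorem expSpline_eq_kernelSeries {z : ℝ} (hz : |z| < 1) {t : ℝ} (ht : 0 < t) (k : ℕ) {x : ℝ} (hx : 0 ≤ x) :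
    expSpline t k z x = (1 - z) ^ k * (trigQuad t).eval z ^ 2 * kernelSeries t k z x := by
  induction k generalizing x with
  | zero => rw [expSpline_zero_eq hz, pow_zero, one_mul]
  | succ k ih =>
    have hint : ∀ y, 0 ≤ y → ∫ s in (0 : ℝ)..y, expSpline t k z s
        = (1 - z) ^ k * (trigQuad t).eval z ^ 2
          * (kernelSeries t (k + 1) z y - kernelSeries t (k + 1) z 0) := by
      intro y hy
      rw [← integral_kernelSeries hz hy ht.le, ← intervalIntegral.integral_const_mul]
      refine intervalIntegral.integral_congr fun s hs => ?_
      rw [Set.uIcc_of_le hy] at hs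
      exact ih hs.1
    simp only [expSpline]
    rw [hint x hx, hint t ht.le]
    linear_combination (-(1 - z) ^ k * (trigQuad t).eval z ^ 2) * kernelSeries_zero_right hz ht.le (k + 1)


/-! ### The bracket as an iterated primitive, and the roots of 𝒫 -/

theorem greenBracket_eq_sum_range (m : ℕ) (y : ℝ) :
    greenBracket m y = (2 * (m : ℝ) - 3) * Real.sin y - y * Real.cos y
      + 2 * ∑ i ∈ range (m - 2), (-1) ^ (i + 1) * ((m : ℝ) - i - 2) * y ^ (2 * i + 1)
          / (Nat.factorial (2 * i + 1) : ℝ) := by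
  rw [greenBracket]
  congr 2
  refine Finset.sum_nbij' (fun k => k - 1) (fun i => i + 1) ?_ ?_ ?_ ?_ ?_
  · intro k hk
    have := Finset.mem_Icc.mp hk
    exact Finset.mem_range.mpr (by omega)
  · intro i hi
    have := Finset.mem_range.mp hi
    exact Finset.mem_Icc.mpr (by omega)
  · intro k hk
    have := Finset.mem_Icc.mp hk
    omega
  · intro i _
    omega
  · intro k hk
    obtain ⟨i, rfl⟩ : ∃ i, k = i + 1 := ⟨k - 1, by have := Finset.mem_Icc.mp hk; omega⟩
    rw [Nat.add_sub_cancel, show 2 * (i + 1) - 1 = 2 * i + 1 by omega]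
    push_cast
    ring

theorem greenBracket_zero_right (m : ℕ) : greenBracket m 0 = 0 := by
  simp [greenBracket_eq_sum_range]

/-- Since `(y cos y)'' = -2 sin y - y cos y`, two derivatives lower the sine coefficient by 2 and
reverse the sign. The condition `F 0 = 0` lets both integrations start at 0 without constants. -/
theorem greenBracket_deriv_two (m : ℕ) : ∃ F : ℝ → ℝ, F 0 = 0 ∧
    (∀ y, HasDerivAt (greenBracket (m + 2)) (F y) y) ∧ ∀ y, HasDerivAt F (-greenBracket (m + 1) y) y := by
  -- The sine contributes `2 * (m + 2) - 3` and the derivative of `y cos y` the `-1`; at 0 this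
  -- cancels against the term `i = 0` of the sum.
  refine ⟨fun y => (2 * (m : ℝ) + 1 - 1) * Real.cos y + y * Real.sin y
      + 2 * ∑ i ∈ range m, (-1) ^ (i + 1) * ((m : ℝ) - i) * y ^ (2 * i)
          / (Nat.factorial (2 * i) : ℝ), ?_, ?_, ?_⟩
  · rcases m with _ | m
    · simp
    · dsimp only
      rw [Finset.sum_range_succ']
      simp
      ring
  · intro y
    have h := ((Real.hasDerivAt_sin y).const_mul (2 * ((m + 2 : ℕ) : ℝ) - 3)).sub
      ((hasDerivAt_id y).mul (Real.hasDerivAt_cos y))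
    have hs : HasDerivAt (fun y : ℝ => ∑ i ∈ range m, (-1) ^ (i + 1) * (((m + 2 : ℕ) : ℝ) - i - 2) * y ^ (2 * i + 1)
          / (Nat.factorial (2 * i + 1) : ℝ)) (∑ i ∈ range m, (-1) ^ (i + 1) * ((m : ℝ) - i) * y ^ (2 * i)
          / (Nat.factorial (2 * i) : ℝ)) y := by
      refine HasDerivAt.fun_sum fun i _ => ?_
      refine (((hasDerivAt_pow (2 * i + 1) y).const_mul _).div_const _).congr_deriv ?_
      rw [Nat.factorial_succ]
      have : (Nat.factorial (2 * i) : ℝ) ≠ 0 := by positivity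
      have : (((2 * i + 1 : ℕ)) : ℝ) ≠ 0 := by positivity
      push_cast at *
      field_simp
      ring
    have h2 := h.add (hs.const_mul 2)
    have e : greenBracket (m + 2) = fun y => (2 * ((m + 2 : ℕ) : ℝ) - 3) * Real.sin y - y * Real.cos y
      + 2 * ∑ i ∈ range m, (-1) ^ (i + 1) * (((m + 2 : ℕ) : ℝ) - i - 2) * y ^ (2 * i + 1)
          / (Nat.factorial (2 * i + 1) : ℝ) := funext fun y => greenBracket_eq_sum_range (m + 2) y
    rw [e]
    refine h2.congr_deriv ?_
    push_cast
    simp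
    ring
  · intro y
    have h := ((Real.hasDerivAt_cos y).const_mul (2 * (m : ℝ) + 1 - 1)).add
      ((hasDerivAt_id y).mul (Real.hasDerivAt_sin y))
    have hs : HasDerivAt (fun y : ℝ => ∑ i ∈ range m, (-1) ^ (i + 1) * ((m : ℝ) - i) * y ^ (2 * i)
          / (Nat.factorial (2 * i) : ℝ))
        (-∑ i ∈ range (m - 1), (-1) ^ (i + 1) * (((m + 1 : ℕ) : ℝ) - i - 2) * y ^ (2 * i + 1)
          / (Nat.factorial (2 * i + 1) : ℝ)) y := by
      rcases m with _ | m
      · simpa using hasDerivAt_const y (0 : ℝ)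
      · simp_rw [Finset.sum_range_succ']
        rw [← Finset.sum_neg_distrib]
        simp only [mul_zero, pow_zero]
        refine HasDerivAt.add_const _ (HasDerivAt.fun_sum fun i _ => ?_)
        refine (((hasDerivAt_pow (2 * (i + 1)) y).const_mul _).div_const _).congr_deriv ?_
        rw [show 2 * (i + 1) = 2 * i + 1 + 1 by ring, Nat.factorial_succ (2 * i + 1)]
        have : (Nat.factorial (2 * i + 1) : ℝ) ≠ 0 := by positivity
        have : (((2 * i + 1 + 1 : ℕ)) : ℝ) ≠ 0 := by positivity
        push_cast at *
        field_simp
        simp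
        ring
    refine (h.add (hs.const_mul 2)).congr_deriv ?_
    rw [greenBracket_eq_sum_range]
    push_cast
    simp
    ring

theorem iterKernel_even_eq (j : ℕ) (y : ℝ) :
    iterKernel (2 * j) y = (-1) ^ (j + 1) * greenBracket (j + 1) y / 2 := by
  induction j generalizing y with
  | zero => simp [iterKernel, greenBracket]; ring
  | succ j ih =>
    obtain ⟨F, hF0, hF, hF'⟩ := greenBracket_deriv_two j
    have h1 : ∀ y, iterKernel (2 * j + 1) y = (-1) ^ (j + 2) * F y / 2 := by
      intro y
      have h : ∀ y, HasDerivAt (fun y => (-1) ^ (j + 2) * F y / 2) (iterKernel (2 * j) y) y := by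
        intro y
        refine (((hF' y).const_mul _).div_const 2).congr_deriv ?_
        rw [ih, pow_succ _ (j + 1)]
        ring
      simp only [iterKernel]
      rw [intervalIntegral.integral_eq_sub_of_hasDerivAt (fun x _ => h x)
        ((iterKernel_continuous _).intervalIntegrable _ _), hF0]
      simp
    have h : ∀ y, HasDerivAt (fun y => (-1) ^ (j + 2) * greenBracket (j + 2) y / 2) (iterKernel (2 * j + 1) y) y := by
      intro y
      rw [h1]
      exact ((hF y).const_mul _).div_const 2
    rw [show 2 * (j + 1) = 2 * j + 1 + 1 by ring, iterKernel]
    rw [intervalIntegral.integral_eq_sub_of_hasDerivAt (fun x _ => h x)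
        ((iterKernel_continuous _).intervalIntegrable _ _), greenBracket_zero_right]
    simp

/-- Evaluation at `x = 0` turns the spline into the generating function of the bracket on the grid.
The factor `z` on the right is the `X` in front of 𝒫 there, and on the left it is quasi-periodicity.
-/
theorem expSpline_left_eq_polyP {m : ℕ} (hm : 2 ≤ m) {t z : ℝ} (ht : 0 < t) (hz : |z| < 1) :
    z * expSpline t (2 * (m - 1)) z t = z * ((-1) ^ m / 2 * (1 - z) ^ 2 * (polyP m t).eval z) := by
  rw [← expSpline_quasiPeriodic, expSpline_eq_kernelSeries hz ht _ le_rfl]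
  have h1 : ∀ n : ℕ, greenBracket m (t * n) = 2 * (-1) ^ m * iterKernel (2 * (m - 1)) (0 + n * t) := by
    intro n
    rw [iterKernel_even_eq, Nat.sub_add_cancel (by omega), zero_add, mul_comm (n : ℝ) t]
    have : ((-1 : ℝ) ^ m) * (-1) ^ m = 1 := by rw [← mul_pow]; simp
    linear_combination (-greenBracket m (t * n)) * this
  have h2 := eval_mul_tsum_of_mk_mul (z := z) (mk_greenBracket_mul hm t) (by
    simp_rw [h1, mul_assoc (2 * (-1 : ℝ) ^ m), norm_mul (2 * (-1 : ℝ) ^ m)]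
    exact (summable_norm_iterKernel hz le_rfl ht.le _).mul_left _)
  simp_rw [h1, mul_assoc (2 * (-1 : ℝ) ^ m)] at h2
  rw [tsum_mul_left, ← kernelSeries, annihilator, ← trigQuad] at h2
  simp only [eval_mul, eval_pow, eval_sub, eval_one, eval_X] at h2
  have : ((-1 : ℝ) ^ m) * (-1) ^ m = 1 := by rw [← mul_pow]; simp
  rw [show 2 * (m - 1) = 2 * m - 4 + 2 by omega, pow_add] at *
  linear_combination ((-1) ^ m / 2 * (1 - z) ^ 2) * h2
    - ((1 - z) ^ (2 * m - 4) * (1 - z) ^ 2 * eval z (trigQuad t) ^ 2 * kernelSeries t (2 * m - 4 + 2) z 0) * this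

/-- Cancel `z`; the value at `z = 0` follows by continuity and is what shows that the leading
coefficient of 𝒫 is nonzero. -/
theorem expSpline_right_eq_polyP {m : ℕ} (hm : 2 ≤ m) {t z : ℝ} (ht : 0 < t) (hz : |z| < 1) :
    expSpline t (2 * (m - 1)) z t = (-1) ^ m / 2 * (1 - z) ^ 2 * (polyP m t).eval z := by
  rcases eq_or_ne z 0 with rfl | hz0
  · have h1 : Continuous fun z => expSpline t (2 * (m - 1)) z t :=
      (expSpline_continuous t _).comp (continuous_id.prodMk continuous_const)
    have h2 : Continuous fun z => (-1) ^ m / 2 * (1 - z) ^ 2 * (polyP m t).eval z := by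
      have := (polyP m t).continuous
      fun_prop
    refine tendsto_nhds_unique_of_eventuallyEq (l := nhdsWithin (0 : ℝ) {0}ᶜ)
      (h1.continuousAt.tendsto.mono_left nhdsWithin_le_nhds)
      (h2.continuousAt.tendsto.mono_left nhdsWithin_le_nhds) ?_
    have h3 : ∀ᶠ z : ℝ in nhds 0, |z| < 1 := by
      have : Continuous fun z : ℝ => |z| := continuous_abs
      exact this.continuousAt.eventually_lt_const (by simp)
    filter_upwards [h3.filter_mono nhdsWithin_le_nhds, self_mem_nhdsWithin] with z h4 h5
    exact mul_left_cancel₀ h5 (expSpline_left_eq_polyP hm ht h4)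
  · exact mul_left_cancel₀ hz0 (expSpline_left_eq_polyP hm ht hz)

theorem polyP_eval_zero_ne_zero {m : ℕ} (hm : 2 ≤ m) {t : ℝ} (ht : 0 < t) (ht1 : t ≤ 1) :
    (polyP m t).eval 0 ≠ 0 := by
  intro h
  have h1 := expSpline_right_eq_polyP hm ht (z := 0) (by simp)
  rw [h, mul_zero] at h1
  exact (expSpline_at_zero_pos ht1 _ t ⟨ht, le_rfl⟩).ne' h1

theorem exists_zeros_polyP {m : ℕ} (hm : 2 ≤ m) {t : ℝ} (ht : 0 < t) (ht1 : t ≤ 1) :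
    ∃ lam : Fin (m - 1) → ℝ, Function.Injective lam ∧
      ∀ i, lam i ∈ Set.Ioo (-1 : ℝ) 0 ∧ (polyP m t).eval (lam i) = 0 := by
  obtain ⟨lam, hinj, hlam⟩ := exists_zeros_expSpline ht ht1 (m - 1)
  refine ⟨lam, hinj, fun i => ⟨(hlam i).1, ?_⟩⟩
  have h1 := (hlam i).1
  have h2 := (hlam i).2
  rw [expSpline_right_eq_polyP hm ht (abs_lt.mpr ⟨h1.1, h1.2.trans zero_lt_one⟩)] at h2
  refine (mul_eq_zero.mp h2).resolve_left ?_
  have : 1 - lam i ≠ 0 := by linarith [h1.2]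
  positivity

/-! ### Factorisation of 𝒫 and residue sums -/

theorem eq_C_mul_nodal {ι : Type*} [Fintype ι] {P : ℝ[X]} {v : ι → ℝ}
    (hv : Function.Injective v) (hd : P.natDegree ≤ Fintype.card ι) (hP : ∀ i, P.eval (v i) = 0) :
    P = C (P.coeff (Fintype.card ι)) * Lagrange.nodal univ v := by
  refine sub_eq_zero.mp (eq_zero_of_degree_lt_of_eval_index_eq_zero (s := univ) hv.injOn ?_ ?_)
  · have hn : (Lagrange.nodal univ v).natDegree = Fintype.card ι := by
      rw [Lagrange.natDegree_nodal, card_univ]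
    rw [card_univ, degree_lt_iff_coeff_zero]
    intro k hk
    rw [coeff_sub, coeff_C_mul]
    rcases hk.eq_or_lt with rfl | hk
    · have : (Lagrange.nodal univ v).coeff (Fintype.card ι) = 1 := by
        conv_lhs => rw [← hn]
        exact Lagrange.nodal_monic
      rw [this]
      ring
    · rw [coeff_eq_zero_of_natDegree_lt (hd.trans_lt hk), coeff_eq_zero_of_natDegree_lt (hn.trans_lt hk)]
      ring
  · intro i hi
    rw [eval_sub, eval_mul, hP, Lagrange.eval_nodal_at_node hi]
    ring

/-- The residue theorem for `f / P` on the sphere, read off from the top coefficient of Lagrange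
interpolation. -/
theorem sum_eval_div_derivative {ι : Type*} [Fintype ι] [DecidableEq ι] {P : ℝ[X]} {v : ι → ℝ} {p : ℝ}
    (hv : Function.Injective v) (hP : P = C p * Lagrange.nodal univ v) {f : ℝ[X]}
    (hf : f.degree < Fintype.card ι) :
    ∑ i, f.eval (v i) / (derivative P).eval (v i) = f.coeff (Fintype.card ι - 1) / p := by
  have h := Lagrange.coeff_eq_sum (s := univ) (v := v) hv.injOn (P := f) (by rwa [card_univ])
  rw [card_univ] at h
  rw [h, Finset.sum_div]
  refine Finset.sum_congr rfl fun i hi => ?_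
  rw [hP, derivative_C_mul, eval_mul, eval_C, Lagrange.eval_nodal_derivative_eval_node_eq hi,
    Lagrange.eval_nodal, div_div, mul_comm p]

/-- The numbers `lam i` together with their inverses. -/
def reciprocalNodes {n : ℕ} (lam : Fin n → ℝ) : Fin n ⊕ Fin n → ℝ :=
  Sum.elim lam fun i => (lam i)⁻¹

theorem reciprocalNodes_injective {n : ℕ} {lam : Fin n → ℝ} (hinj : Function.Injective lam)
    (hlam : ∀ i, lam i ∈ Set.Ioo (-1 : ℝ) 0) : Function.Injective (reciprocalNodes lam) := by
  have hinv : ∀ i, (lam i)⁻¹ < -1 := by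
    intro i
    have h := hlam i
    rw [inv_lt_of_neg h.2 (by norm_num)]
    simpa using h.1
  refine hinj.sumElim (inv_injective.comp hinj) fun i j h => ?_
  have := hinv j
  have := (hlam i).1
  linarith

section roots

variable {m : ℕ} {t : ℝ} {lam : Fin (m - 1) → ℝ}

theorem polyP_eq_nodal (hm : 2 ≤ m) (hinj : Function.Injective lam)
    (hlam : ∀ i, lam i ∈ Set.Ioo (-1 : ℝ) 0) (hroot : ∀ i, (polyP m t).eval (lam i) = 0) :
    polyP m t = C ((polyP m t).coeff (2 * m - 2)) * Lagrange.nodal univ (reciprocalNodes lam) := by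
  have hcard : Fintype.card (Fin (m - 1) ⊕ Fin (m - 1)) = 2 * m - 2 := by
    simp
    omega
  have h := eq_C_mul_nodal (P := polyP m t) (reciprocalNodes_injective hinj hlam)
    (by rw [hcard]; exact polyP_natDegree_le hm t) (by
      rintro (i | i)
      · exact hroot i
      · have h1 := polyP_selfReciprocal hm t (lam i) (hlam i).2.ne
        rw [hroot i] at h1
        exact (mul_eq_zero.mp h1).resolve_left (pow_ne_zero _ (hlam i).2.ne))
  rwa [hcard] at h

theorem polyP_derivative_eval_ne_zero (hm : 2 ≤ m) (hp : (polyP m t).coeff (2 * m - 2) ≠ 0)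
    (hinj : Function.Injective lam)
    (hlam : ∀ i, lam i ∈ Set.Ioo (-1 : ℝ) 0) (hroot : ∀ i, (polyP m t).eval (lam i) = 0)
    (i : Fin (m - 1)) : (derivative (polyP m t)).eval (lam i) ≠ 0 := by
  have hv := reciprocalNodes_injective hinj hlam
  rw [polyP_eq_nodal hm hinj hlam hroot, derivative_C_mul, eval_mul, eval_C]
  refine mul_ne_zero hp ?_
  have h := Lagrange.eval_nodal_derivative_eval_node_eq (v := reciprocalNodes lam) (mem_univ (Sum.inl i))
  change eval (reciprocalNodes lam (Sum.inl i)) _ ≠ 0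
  rw [h, Lagrange.eval_nodal, Finset.prod_ne_zero_iff]
  intro j hj
  exact sub_ne_zero.mpr fun h => (Finset.mem_erase.mp hj).1 (hv h).symm

theorem polyP_aeval_eq_zero_iff (hm : 2 ≤ m) (hp : (polyP m t).coeff (2 * m - 2) ≠ 0)
    (hinj : Function.Injective lam)
    (hlam : ∀ i, lam i ∈ Set.Ioo (-1 : ℝ) 0) (hroot : ∀ i, (polyP m t).eval (lam i) = 0) (z : ℂ) :
    (aeval z (polyP m t) = 0 ∧ ‖z‖ < 1) ↔ ∃ k, ((lam k : ℝ) : ℂ) = z := by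
  constructor
  · rintro ⟨hz, hz1⟩
    rw [polyP_eq_nodal hm hinj hlam hroot, map_mul, aeval_C, Lagrange.nodal, map_prod] at hz
    have h1 := (mul_eq_zero.mp hz).resolve_left (by simpa using hp)
    obtain ⟨i, -, hi⟩ := Finset.prod_eq_zero_iff.mp h1
    have hi' : z = ((reciprocalNodes lam i : ℝ) : ℂ) := by
      simpa [sub_eq_zero] using hi
    rcases i with i | i
    · exact ⟨i, hi'.symm⟩
    · rw [hi', Complex.norm_real, Real.norm_eq_abs] at hz1
      simp only [reciprocalNodes, Sum.elim_inr, abs_inv] at hz1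
      have h2 : |lam i| < 1 := abs_lt.mpr ⟨(hlam i).1, (hlam i).2.trans zero_lt_one⟩
      have h3 := (one_lt_inv₀ (abs_pos.mpr (hlam i).2.ne)).mpr h2
      exact absurd hz1 h3.not_gt
  · rintro ⟨k, rfl⟩
    refine ⟨?_, ?_⟩
    · have := aeval_algebraMap_apply ℂ (lam k) (polyP m t)
      rw [Complex.coe_algebraMap] at this
      rw [this]
      simp [hroot k]
    · rw [Complex.norm_real, Real.norm_eq_abs]
      exact abs_lt.mpr ⟨(hlam k).1, (hlam k).2.trans zero_lt_one⟩

/-- The residue sums `∑ₖ cₖ (λₖʲ - λₖ⁻ʲ)` with `cₖ = λₖ^(m-2) / 𝒫'(λₖ)`. -/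
def residueSum (m : ℕ) (t : ℝ) (lam : Fin (m - 1) → ℝ) (j : ℕ) : ℝ :=
  ∑ k, lam k ^ (m - 2) / (derivative (polyP m t)).eval (lam k) * (lam k ^ j - (lam k)⁻¹ ^ j)

/-- Reciprocity gives `𝒫'(1/λ) = -λ² 𝒫'(λ) / λ^(2m-2)`, so each negative power of `λ` in the sum is
the residue of the same function at the reciprocal root. -/
theorem residueSum_eq_sum_nodes (hm : 2 ≤ m) (hp : (polyP m t).coeff (2 * m - 2) ≠ 0)
    (hinj : Function.Injective lam)
    (hlam : ∀ i, lam i ∈ Set.Ioo (-1 : ℝ) 0) (hroot : ∀ i, (polyP m t).eval (lam i) = 0) (j : ℕ) :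
    residueSum m t lam j = ∑ i, (X ^ (m - 2 + j) : ℝ[X]).eval (reciprocalNodes lam i)
      / (derivative (polyP m t)).eval (reciprocalNodes lam i) := by
  rw [residueSum, Fintype.sum_sum_type, ← Finset.sum_add_distrib]
  refine Finset.sum_congr rfl fun k _ => ?_
  have h0 : lam k ≠ 0 := (hlam k).2.ne
  have hd := polyP_derivative_eval_ne_zero hm hp hinj hlam hroot k
  have h1 := eval_derivative_of_selfReciprocal (polyP_selfReciprocal hm t) h0
  rw [hroot k] at h1
  simp only [reciprocalNodes, Sum.elim_inl, Sum.elim_inr, eval_pow, eval_X]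
  set d := (derivative (polyP m t)).eval (lam k)
  have h2 : (derivative (polyP m t)).eval (lam k)⁻¹ = -(lam k) ^ 2 * d / lam k ^ (2 * m - 2) := by
    rw [eq_div_iff (pow_ne_zero _ h0)]
    linear_combination h1
  rw [h2, show 2 * m - 2 = (m - 2) + (m - 2) + 2 by omega, pow_add, pow_add, pow_add, pow_add, inv_pow, inv_pow]
  field_simp
  ring

theorem residueSum_of_le (hm : 2 ≤ m) (hp : (polyP m t).coeff (2 * m - 2) ≠ 0)
    (hinj : Function.Injective lam)
    (hlam : ∀ i, lam i ∈ Set.Ioo (-1 : ℝ) 0) (hroot : ∀ i, (polyP m t).eval (lam i) = 0) {j : ℕ}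
    (hj : j ≤ m - 1) :
    residueSum m t lam j = if j = m - 1 then 1 / (polyP m t).coeff (2 * m - 2) else 0 := by
  have hcard : Fintype.card (Fin (m - 1) ⊕ Fin (m - 1)) = 2 * m - 2 := by
    simp
    omega
  rw [residueSum_eq_sum_nodes hm hp hinj hlam hroot,
    sum_eval_div_derivative (reciprocalNodes_injective hinj hlam) (polyP_eq_nodal hm hinj hlam hroot) (by
      rw [hcard, degree_X_pow]
      exact_mod_cast (by omega : m - 2 + j < 2 * m - 2)), hcard, coeff_X_pow]
  split_ifs with h1 h2 h2
  · rfl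
  · omega
  · omega
  · rw [zero_div]

theorem residueSum_self (hm : 2 ≤ m) (hp : (polyP m t).coeff (2 * m - 2) ≠ 0)
    (hinj : Function.Injective lam)
    (hlam : ∀ i, lam i ∈ Set.Ioo (-1 : ℝ) 0) (hroot : ∀ i, (polyP m t).eval (lam i) = 0) :
    residueSum m t lam m
      = -((polyP m t).coeff (2 * m - 3) / (polyP m t).coeff (2 * m - 2)) / (polyP m t).coeff (2 * m - 2) := by
  have hcard : Fintype.card (Fin (m - 1) ⊕ Fin (m - 1)) = 2 * m - 2 := by
    simp
    omega
  have hnodal := polyP_eq_nodal hm hinj hlam hroot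
  set p := (polyP m t).coeff (2 * m - 2)
  have hroot' : ∀ i, (polyP m t).eval (reciprocalNodes lam i) = 0 := fun i => by
    rw [hnodal, eval_mul, Lagrange.eval_nodal_at_node (mem_univ i), mul_zero]
  have h := sum_eval_div_derivative (reciprocalNodes_injective hinj hlam) hnodal
    -- The monomial has degree one too large for Lagrange's formula; subtracting `𝒫 / p` lowers the
    -- degree without changing values at the nodes.
    (f := X ^ (2 * m - 2) - C p⁻¹ * polyP m t) (by
      rw [hcard, degree_lt_iff_coeff_zero]
      intro k hk
      rw [coeff_sub, coeff_C_mul, coeff_X_pow]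
      rcases hk.eq_or_lt with rfl | hk
      · rw [if_pos rfl, inv_mul_cancel₀ hp, sub_self]
      · rw [if_neg hk.ne', coeff_eq_zero_of_natDegree_lt ((polyP_natDegree_le hm t).trans_lt hk), mul_zero, sub_zero])
  rw [residueSum_eq_sum_nodes hm hp hinj hlam hroot, show m - 2 + m = 2 * m - 2 by omega]
  simp only [eval_sub, eval_mul, hroot', mul_zero, sub_zero] at h
  rw [h, hcard, show 2 * m - 2 - 1 = 2 * m - 3 by omega, coeff_sub, coeff_C_mul, coeff_X_pow, if_neg (by omega)]
  field_simp
  ring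

end roots

/-! ### Laurent polynomials acting on sequences, and convolution -/

/-- The action on bi-infinite sequences of the Laurent polynomial `X^(-e) A`, where `deg A ≤ 2 e`. -/
def laurentAct (A : ℝ[X]) (e : ℕ) (x : ℤ → ℝ) (n : ℤ) : ℝ :=
  ∑ s ∈ range (2 * e + 1), A.coeff s * x (n + e - s)

/-- Convolution of bi-infinite sequences. -/
def intConv (x y : ℤ → ℝ) (β : ℤ) : ℝ := ∑' γ : ℤ, x γ * y (β - γ)

/-- All the series defining `intConv x y` converge. -/
def IntConvSummable (x y : ℤ → ℝ) : Prop := ∀ β : ℤ, Summable fun γ : ℤ => x γ * y (β - γ)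

theorem hasSum_laurentAct_right {x y : ℤ → ℝ} (h : IntConvSummable x y) (A : ℝ[X]) (e : ℕ) (β : ℤ) :
    HasSum (fun γ => x γ * laurentAct A e y (β - γ)) (laurentAct A e (intConv x y) β) := by
  have h1 := hasSum_sum (s := range (2 * e + 1)) (f := fun (s : ℕ) γ => A.coeff s * (x γ * y (β + e - s - γ)))
    (a := fun s : ℕ => A.coeff s * intConv x y (β + e - s)) fun s _ => (h (β + e - s)).hasSum.mul_left _
  refine h1.congr_fun ?_ 
  intro γ
  rw [laurentAct, Finset.mul_sum]
  refine Finset.sum_congr rfl fun s _ => ?_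
  rw [show β - γ + e - s = β + e - s - γ by ring]
  ring

theorem hasSum_laurentAct_left {x y : ℤ → ℝ} (h : IntConvSummable x y) (A : ℝ[X]) (e : ℕ) (β : ℤ) :
    HasSum (fun γ => laurentAct A e x γ * y (β - γ)) (laurentAct A e (intConv x y) β) := by
  have h1 := hasSum_sum (s := range (2 * e + 1))
    (f := fun (s : ℕ) γ => A.coeff s * (x (γ + (e - s)) * y (β + e - s - (γ + (e - s)))))
    (a := fun s : ℕ => A.coeff s * intConv x y (β + e - s)) fun s _ =>
      (((Equiv.addRight ((e : ℤ) - s)).hasSum_iff (f := fun γ => x γ * y (β + e - s - γ))).mpr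
        (h (β + e - s)).hasSum).mul_left _
  refine h1.congr_fun ?_ 
  intro γ
  rw [laurentAct, Finset.sum_mul]
  refine Finset.sum_congr rfl fun s _ => ?_
  rw [show β + e - s - (γ + (e - s)) = β - γ by ring, add_sub_assoc]
  ring

theorem intConv_laurentAct_right {x y : ℤ → ℝ} (h : IntConvSummable x y) (A : ℝ[X]) (e : ℕ) :
    intConv x (laurentAct A e y) = laurentAct A e (intConv x y) :=
  funext fun β => (hasSum_laurentAct_right h A e β).tsum_eq

theorem intConv_laurentAct_left {x y : ℤ → ℝ} (h : IntConvSummable x y) (A : ℝ[X]) (e : ℕ) :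
    intConv (laurentAct A e x) y = laurentAct A e (intConv x y) :=
  funext fun β => (hasSum_laurentAct_left h A e β).tsum_eq

theorem hasSum_discreteDelta (x : ℤ → ℝ) (β : ℤ) :
    HasSum (fun γ => x γ * discreteDelta (β - γ)) (x β) := by
  have h := hasSum_single (f := fun γ => x γ * discreteDelta (β - γ)) β (fun γ hγ => by
    rw [discreteDelta, if_neg (by omega), mul_zero])
  simpa [discreteDelta] using h

theorem intConvSummable_discreteDelta (x : ℤ → ℝ) : IntConvSummable x discreteDelta :=
  fun β => (hasSum_discreteDelta x β).summable

theorem intConv_discreteDelta (x : ℤ → ℝ) : intConv x discreteDelta = x :=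
  funext fun β => (hasSum_discreteDelta x β).tsum_eq

theorem intConv_zero_left (y : ℤ → ℝ) : intConv 0 y = 0 := by
  funext β
  simp [intConv]

theorem laurentAct_zero (A : ℝ[X]) (e : ℕ) : laurentAct A e 0 = 0 := by
  funext n
  simp [laurentAct]

theorem laurentAct_const_mul (A : ℝ[X]) (e : ℕ) (c : ℝ) (x : ℤ → ℝ) :
    laurentAct A e (fun n => c * x n) = fun n => c * laurentAct A e x n := by
  funext n
  rw [laurentAct, laurentAct, Finset.mul_sum]
  exact Finset.sum_congr rfl fun s _ => by ring

theorem sum_coeff_mul_reflect {A : ℝ[X]} {e : ℕ} (hA : ∀ i ≤ 2 * e, A.coeff i = A.coeff (2 * e - i))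
    (F : ℤ → ℝ) : ∑ s ∈ range (2 * e + 1), A.coeff s * F s
      = ∑ s ∈ range (2 * e + 1), A.coeff s * F (2 * e - s) := by
  rw [← Finset.sum_range_reflect]
  refine Finset.sum_congr rfl fun s hs => ?_
  have hs' : s ≤ 2 * e := Nat.lt_succ_iff.mp (Finset.mem_range.mp hs)
  rw [Nat.add_sub_cancel, hA s hs', Nat.cast_sub hs']
  push_cast
  rfl

theorem laurentAct_even {A : ℝ[X]} {e : ℕ} (hA : ∀ i ≤ 2 * e, A.coeff i = A.coeff (2 * e - i))
    {x : ℤ → ℝ} (hx : ∀ n, x (-n) = x n) (n : ℤ) : laurentAct A e x (-n) = laurentAct A e x n := by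
  rw [laurentAct, sum_coeff_mul_reflect hA fun s => x (-n + e - s), laurentAct]
  refine Finset.sum_congr rfl fun s _ => ?_
  rw [← hx]
  congr 2
  ring

/-! ### The difference equation of the Green sequence -/

/-- `greenBracket` on the grid, extended evenly. -/
def greenSeq (m : ℕ) (t : ℝ) (n : ℤ) : ℝ := greenBracket m (t * n.natAbs)

theorem greenBracket_neg (m : ℕ) (y : ℝ) : greenBracket m (-y) = -greenBracket m y := by
  simp only [greenBracket_eq_sum_range, Real.sin_neg, Real.cos_neg]
  have : ∀ i : ℕ, (-y) ^ (2 * i + 1) = -y ^ (2 * i + 1) := fun i => Odd.neg_pow ⟨i, rfl⟩ y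
  simp only [this, mul_neg, neg_div, Finset.sum_neg_distrib]
  ring

/-- Comparison of coefficients in `mk_greenBracket_mul`, for the one-sided sequence extended by 0 to
negative indices. -/
theorem sum_annihilator_mul_greenBracket {m : ℕ} (hm : 2 ≤ m) (t : ℝ) (N : ℤ) :
    ∑ s ∈ range (2 * m + 1), (annihilator m t).coeff s
        * (if 0 ≤ N - s then greenBracket m (t * ((N - s : ℤ) : ℝ)) else 0)
      = ∑ s ∈ range (2 * (m - 1) + 1), (polyP m t).coeff s * discreteDelta (N - 1 - s) := by
  rcases lt_or_ge N 0 with hN | hN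
  · rw [Finset.sum_eq_zero, Finset.sum_eq_zero]
    · intro s _
      rw [discreteDelta, if_neg (by omega), mul_zero]
    · intro s _
      rw [if_neg (by omega), mul_zero]
  lift N to ℕ using hN
  have h := congrArg (PowerSeries.coeff N) (mk_greenBracket_mul hm t)
  rw [mul_comm, PowerSeries.coeff_mul, Finset.Nat.sum_antidiagonal_eq_sum_range_succ
    (fun i j => PowerSeries.coeff i (annihilator m t : PowerSeries ℝ)
      * PowerSeries.coeff j (PowerSeries.mk fun n : ℕ => greenBracket m (t * n)))] at h
  simp only [Polynomial.coeff_coe, PowerSeries.coeff_mk] at h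
  have h1 : ∀ s ∈ range (N + 1), (annihilator m t).coeff s
        * (if (0 : ℤ) ≤ N - s then greenBracket m (t * ((N - s : ℤ) : ℝ)) else 0)
      = (annihilator m t).coeff s * greenBracket m (t * ((N - s : ℕ) : ℝ)) := by
    intro s hs
    have hs' : s ≤ N := Nat.lt_succ_iff.mp (Finset.mem_range.mp hs)
    rw [if_pos (by omega), Nat.cast_sub hs']
    push_cast
    rfl
  rw [← Finset.sum_congr rfl h1] at h
  have h2 : ∀ a b : ℕ, (∀ s, a ≤ s → s < b → (annihilator m t).coeff s
        * (if (0 : ℤ) ≤ N - s then greenBracket m (t * ((N - s : ℤ) : ℝ)) else 0) = 0) → a ≤ b →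
      ∑ s ∈ range b, (annihilator m t).coeff s
        * (if (0 : ℤ) ≤ N - s then greenBracket m (t * ((N - s : ℤ) : ℝ)) else 0)
      = ∑ s ∈ range a, (annihilator m t).coeff s
        * (if (0 : ℤ) ≤ N - s then greenBracket m (t * ((N - s : ℤ) : ℝ)) else 0) := by
    intro a b hz hab
    refine (Finset.sum_subset (Finset.range_mono hab) fun s hs hs' => ?_).symm
    exact hz s (by simpa using hs') (by simpa using hs)
  have h3 : ∑ s ∈ range (2 * m + 1), (annihilator m t).coeff s
        * (if (0 : ℤ) ≤ N - s then greenBracket m (t * ((N - s : ℤ) : ℝ)) else 0)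
      = (X * polyP m t).coeff N := by
    rw [← h]
    rcases le_total (N + 1) (2 * m + 1) with hle | hle
    · exact h2 _ _ (fun s hs _ => by rw [if_neg (by omega), mul_zero]) hle
    · refine (h2 _ _ (fun s hs _ => ?_) hle).symm
      rw [coeff_eq_zero_of_natDegree_lt ((annihilator_natDegree_le hm t).trans_lt (by omega)), zero_mul]
  rw [h3]
  rcases N with _ | j
  · rw [coeff_X_mul_zero]
    refine (Finset.sum_eq_zero fun s _ => ?_).symm
    rw [discreteDelta, if_neg (by omega), mul_zero]
  · rw [coeff_X_mul]
    by_cases hj : j ∈ range (2 * (m - 1) + 1)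
    · rw [Finset.sum_eq_single_of_mem j hj fun s _ hs => by
        rw [discreteDelta, if_neg (by push_cast; omega), mul_zero]]
      simp [discreteDelta]
    · rw [Finset.mem_range] at hj
      rw [coeff_eq_zero_of_natDegree_lt ((polyP_natDegree_le hm t).trans_lt (by omega))]
      refine (Finset.sum_eq_zero fun s hs => ?_).symm
      have := Finset.mem_range.mp hs
      rw [discreteDelta, if_neg (by push_cast; omega), mul_zero]

theorem polyP_coeff_symm_centered {m : ℕ} (hm : 2 ≤ m) (t : ℝ) :
    ∀ i ≤ 2 * (m - 1), (polyP m t).coeff i = (polyP m t).coeff (2 * (m - 1) - i) := by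
  intro i hi
  have : 2 * (m - 1) = 2 * m - 2 := by omega
  rw [this] at hi ⊢
  exact polyP_coeff_symm hm t hi

theorem discreteDelta_neg (n : ℤ) : discreteDelta (-n) = discreteDelta n := by
  simp [discreteDelta]

/-- The even extension is a one-sided sequence plus its reflection (the value at 0 is 0). As both
polynomials are palindromic, the two halves contribute equally, whence the factor 2. -/
theorem laurentAct_greenSeq {m : ℕ} (hm : 2 ≤ m) (t : ℝ) :
    laurentAct (annihilator m t) m (greenSeq m t)
      = fun n => 2 * laurentAct (polyP m t) (m - 1) discreteDelta n := by
  funext n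
  let g : ℤ → ℝ := fun n => if 0 ≤ n then greenBracket m (t * (n : ℝ)) else 0
  have hg : ∀ n, greenSeq m t n = g n + g (-n) := by
    intro n
    simp only [greenSeq, g]
    rcases lt_trichotomy n 0 with h | rfl | h
    · rw [if_neg (by omega), if_pos (by omega), zero_add, Nat.cast_natAbs, abs_of_neg h]
    · simp [greenBracket_zero_right]
    · rw [if_pos (by omega), if_neg (by omega), add_zero, Nat.cast_natAbs, abs_of_pos h]
  have h1 := sum_annihilator_mul_greenBracket hm t
  have hcast : ((m - 1 : ℕ) : ℤ) = m - 1 := by rw [Nat.cast_sub (by omega)]; rfl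
  have hA : ∑ s ∈ range (2 * m + 1), (annihilator m t).coeff s * g (n + m - s)
      = laurentAct (polyP m t) (m - 1) discreteDelta n := by
    rw [h1 (n + m), laurentAct]
    refine Finset.sum_congr rfl fun s _ => ?_
    rw [hcast]
    congr 2
    ring
  have hB : ∑ s ∈ range (2 * m + 1), (annihilator m t).coeff s * g (-(n + m - s))
      = laurentAct (polyP m t) (m - 1) discreteDelta n := by
    rw [sum_coeff_mul_reflect (fun i hi => annihilator_coeff_symm hm t hi) fun s => g (-(n + m - s))]
    rw [← laurentAct_even (polyP_coeff_symm_centered hm t) discreteDelta_neg, laurentAct]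
    have h2 := h1 (-n + m)
    have h3 : ∀ s : ℕ, -(n + m - (2 * m - s : ℤ)) = -n + m - s := fun s => by ring
    simp_rw [h3]
    refine h2.trans (Finset.sum_congr rfl fun s _ => ?_)
    rw [hcast]
    congr 2
    ring
  rw [two_mul]
  nth_rewrite 1 [← hA]
  rw [← hB, ← Finset.sum_add_distrib, laurentAct]
  refine Finset.sum_congr rfl fun s _ => ?_
  rw [hg]
  ring

/-- On the pure power `x ^ j` the action is multiplication by `x ^ (-e) A(x)`; the second sum
corrects the negative indices, where `|j|` replaces `j`. -/
theorem laurentAct_pow_natAbs {A : ℝ[X]} {e : ℕ} (hA : ∀ i ≤ 2 * e, A.coeff i = A.coeff (2 * e - i))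
    (hd : A.natDegree ≤ 2 * e) {x : ℝ} (hx : x ≠ 0) (n : ℕ) :
    laurentAct A e (fun j => x ^ j.natAbs) n = x ^ n * x⁻¹ ^ e * A.eval x
      + ∑ s ∈ range (2 * e + 1), if n + e < s then A.coeff s * (x ^ (s - n - e) - x⁻¹ ^ (s - n - e)) else 0 := by
  have h1 : A.eval x = ∑ s ∈ range (2 * e + 1), A.coeff s * x ^ (2 * e - s : ℤ) := by
    rw [eval_eq_sum_range' (Nat.lt_succ_iff.mpr hd), ← sum_coeff_mul_reflect hA fun s => x ^ s]
    rfl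
  rw [h1, Finset.mul_sum, ← Finset.sum_add_distrib, laurentAct]
  refine Finset.sum_congr rfl fun s hs => ?_
  have h2 : x ^ n * x⁻¹ ^ e * (A.coeff s * x ^ (2 * e - s : ℤ)) = A.coeff s * x ^ (n + e - s : ℤ) := by
    rw [show (n + e - s : ℤ) = n + -e + (2 * e - s) by ring, zpow_add₀ hx, zpow_add₀ hx, zpow_natCast,
      zpow_neg, zpow_natCast, inv_pow]
    ring
  rw [h2]
  split_ifs with h
  · have h3 : (n + e - s : ℤ).natAbs = s - n - e := by omega
    have h4 : (n + e - s : ℤ) = -((s - n - e : ℕ) : ℤ) := by omega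
    rw [h3, h4, zpow_neg, zpow_natCast, inv_pow]
    ring
  · have h3 : (n + e - s : ℤ) = ((n + e - s : ℕ) : ℤ) := by omega
    rw [h3, zpow_natCast, Int.natAbs_natCast, add_zero]

/-! ### The inverse of 𝒫 and the explicit values of `D_m` -/

/-- The bi-infinite coefficient sequence of `X^(m-1) / 𝒫` on the unit circle. -/
def inverseSeq (m : ℕ) (t : ℝ) (lam : Fin (m - 1) → ℝ) (n : ℤ) : ℝ :=
  ∑ k, lam k ^ (m - 2) / (derivative (polyP m t)).eval (lam k) * lam k ^ n.natAbs

theorem inverseSeq_neg (m : ℕ) (t : ℝ) (lam : Fin (m - 1) → ℝ) (n : ℤ) :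
    inverseSeq m t lam (-n) = inverseSeq m t lam n := by
  simp [inverseSeq]

theorem laurentAct_inverseSeq {m : ℕ} {t : ℝ} {lam : Fin (m - 1) → ℝ} (hlam : ∀ i, lam i ≠ 0)
    {A : ℝ[X]} {e : ℕ} (hA : ∀ i ≤ 2 * e, A.coeff i = A.coeff (2 * e - i))
    (hd : A.natDegree ≤ 2 * e) (n : ℕ) :
    laurentAct A e (inverseSeq m t lam) n
      = ∑ k, lam k ^ (m - 2) / (derivative (polyP m t)).eval (lam k)
          * (lam k ^ n * (lam k)⁻¹ ^ e * A.eval (lam k))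
        + ∑ s ∈ range (2 * e + 1), if n + e < s then A.coeff s * residueSum m t lam (s - n - e) else 0 := by
  have h1 : laurentAct A e (inverseSeq m t lam) n
      = ∑ k, lam k ^ (m - 2) / (derivative (polyP m t)).eval (lam k)
          * laurentAct A e (fun j => lam k ^ j.natAbs) n := by
    simp only [laurentAct, inverseSeq, Finset.mul_sum]
    rw [Finset.sum_comm]
    refine Finset.sum_congr rfl fun k _ => Finset.sum_congr rfl fun s _ => by ring
  rw [h1]
  simp_rw [laurentAct_pow_natAbs hA hd (hlam _), mul_add]
  rw [Finset.sum_add_distrib]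
  congr 1
  simp_rw [Finset.mul_sum]
  rw [Finset.sum_comm]
  refine Finset.sum_congr rfl fun s _ => ?_
  split_ifs with h
  · rw [residueSum, Finset.mul_sum]
    exact Finset.sum_congr rfl fun k _ => by ring
  · simp

section

variable {m : ℕ} {t : ℝ} {lam : Fin (m - 1) → ℝ}

/-- The main terms vanish at the roots, and the correction terms are residue sums of index at most
`m - 1`. Only index `m - 1` survives, and it occurs only for `n = 0`, `s = 2m - 2`. -/
theorem laurentAct_polyP_inverseSeq (hm : 2 ≤ m) (hp : (polyP m t).coeff (2 * m - 2) ≠ 0)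
    (hinj : Function.Injective lam)
    (hlam : ∀ i, lam i ∈ Set.Ioo (-1 : ℝ) 0) (hroot : ∀ i, (polyP m t).eval (lam i) = 0) :
    laurentAct (polyP m t) (m - 1) (inverseSeq m t lam) = discreteDelta := by
  have hs := polyP_coeff_symm_centered hm t
  have hd : (polyP m t).natDegree ≤ 2 * (m - 1) := (polyP_natDegree_le hm t).trans (by omega)
  have main : ∀ n : ℕ, laurentAct (polyP m t) (m - 1) (inverseSeq m t lam) n = discreteDelta n := by
    intro n
    rw [laurentAct_inverseSeq (fun i => (hlam i).2.ne) hs hd n]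
    simp only [hroot, mul_zero, Finset.sum_const_zero, zero_add]
    rw [Finset.sum_range_succ, Finset.sum_eq_zero, zero_add]
    · rcases n with _ | n
      · rw [if_pos (by omega), residueSum_of_le hm hp hinj hlam hroot (by omega), if_pos (by omega),
          show 2 * (m - 1) = 2 * m - 2 by omega]
        simp [discreteDelta, hp]
      · have hz : ((n + 1 : ℕ) : ℤ) ≠ 0 := by omega
        rw [discreteDelta, if_neg hz]
        split_ifs with h
        · rw [residueSum_of_le hm hp hinj hlam hroot (by omega), if_neg (by omega), mul_zero]
        · rfl
    · intro s hs'
      have := Finset.mem_range.mp hs'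
      split_ifs with h
      · rw [residueSum_of_le hm hp hinj hlam hroot (by omega), if_neg (by omega), mul_zero]
      · rfl
  funext n
  rcases Int.natAbs_eq n with h | h <;> rw [h]
  · exact main _
  · rw [laurentAct_even hs (inverseSeq_neg m t lam), discreteDelta_neg]
    exact main _

/-- The annihilator has degree two more than 𝒫, so residue sums of index `m - 1` and `m` both occur,
paired with its top coefficients `1` and `4 - 2m - 4 cos t`. They create the constant `C` at 0 and
the extra 1 at `|β| = 1`. -/
theorem coeff_mul_laurentAct_annihilator (hm : 2 ≤ m) (hp : (polyP m t).coeff (2 * m - 2) ≠ 0)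
    (hinj : Function.Injective lam)
    (hlam : ∀ i, lam i ∈ Set.Ioo (-1 : ℝ) 0) (hroot : ∀ i, (polyP m t).eval (lam i) = 0) (β : ℤ) :
    (polyP m t).coeff (2 * m - 2) * laurentAct (annihilator m t) m (inverseSeq m t lam) β
      = if β = 0 then constC m t + ∑ k, coeffA m t (lam k) / lam k
        else if |β| = 1 then 1 + ∑ k, coeffA m t (lam k)
        else ∑ k, coeffA m t (lam k) * lam k ^ (β.natAbs - 1) := by
  have hs : ∀ i ≤ 2 * m, (annihilator m t).coeff i = (annihilator m t).coeff (2 * m - i) :=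
    fun i hi => annihilator_coeff_symm hm t hi
  have hd0 := annihilator_coeff_zero m t
  have hd1 := annihilator_coeff_one hm t
  have hl0 : (annihilator m t).coeff (2 * m) = 1 := by rw [hs _ le_rfl, Nat.sub_self, hd0]
  have hl1 : (annihilator m t).coeff (2 * m - 1) = 4 - 2 * m - 4 * Real.cos t := by
    rw [hs _ (by omega), show 2 * m - (2 * m - 1) = 1 by omega, hd1]
  have hres : ∀ j, j ≤ m - 1 → _ := fun j hj => residueSum_of_le hm hp hinj hlam hroot (j := j) hj
  have hself := residueSum_self hm hp hinj hlam hroot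
  set p := (polyP m t).coeff (2 * m - 2) with hpdef
  have hA : ∀ k, p * (lam k ^ (m - 2) / (derivative (polyP m t)).eval (lam k)
      * ((lam k)⁻¹ ^ m * (annihilator m t).eval (lam k))) = coeffA m t (lam k) / lam k := by
    intro k
    have h0 := (hlam k).2.ne
    have h1 := polyP_derivative_eval_ne_zero hm hp hinj hlam hroot k
    obtain ⟨j, rfl⟩ : ∃ j, m = j + 2 := ⟨m - 2, by omega⟩
    simp only [coeffA, annihilator, eval_mul, eval_pow, eval_sub, eval_add, eval_one, eval_X, eval_C, eval_ofNat,
      ← hpdef, Nat.add_sub_cancel]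
    rw [inv_pow, pow_add]
    field_simp
  have main : ∀ n : ℕ, p * laurentAct (annihilator m t) m (inverseSeq m t lam) n
      = (∑ k, coeffA m t (lam k) / lam k * lam k ^ n)
        + if n = 0 then constC m t else if n = 1 then 1 else 0 := by
    intro n
    rw [laurentAct_inverseSeq (fun i => (hlam i).2.ne) hs (annihilator_natDegree_le hm t) n, mul_add,
      Finset.mul_sum]
    congr 1
    · refine Finset.sum_congr rfl fun k _ => ?_
      rw [← hA]
      ring
    · rw [Finset.sum_range_succ, show 2 * m = 2 * m - 1 + 1 by omega, Finset.sum_range_succ,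
        Finset.sum_eq_zero, show 2 * m - 1 + 1 = 2 * m by omega, zero_add, hl0, hl1]
      · rcases n with _ | _ | n
        · have c1 : 0 + m < 2 * m - 1 := by omega
          have c2 : 0 + m < 2 * m := by omega
          rw [if_pos c1, if_pos c2, if_pos rfl, show 2 * m - 1 - 0 - m = m - 1 by omega,
            show 2 * m - 0 - m = m by omega, hres _ le_rfl, if_pos rfl, hself, constC, ← hpdef]
          field_simp
          ring
        · have c2 : 0 + 1 + m < 2 * m := by omega
          have c3 : 2 * m - (0 + 1) - m = m - 1 := by omega
          have c4 : (0 : ℕ) + 1 ≠ 0 := by omega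
          rw [if_pos c2, if_neg c4, if_pos rfl, c3, hres _ le_rfl, if_pos rfl]
          split_ifs with h
          · rw [hres _ (by omega), if_neg (by omega)]
            field_simp
            ring
          · field_simp
            ring
        · have c1 : n + 1 + 1 ≠ 0 := by omega
          have c2 : n + 1 + 1 ≠ 1 := by omega
          have c3 : ∀ j, n + 1 + 1 + m < j → j ≤ 2 * m → residueSum m t lam (j - (n + 1 + 1) - m) = 0 := by
            intro j h1 h2
            rw [hres _ (by omega), if_neg (by omega)]
          rw [if_neg c1, if_neg c2]
          split_ifs with h1 h2 h2
          · rw [c3 _ h1 (by omega), c3 _ h2 le_rfl]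
            ring
          · omega
          · rw [c3 _ h2 le_rfl]
            ring
          · ring
      · intro s hs'
        have := Finset.mem_range.mp hs'
        split_ifs with h
        · rw [hres _ (by omega), if_neg (by omega), mul_zero]
        · rfl
  have habs : laurentAct (annihilator m t) m (inverseSeq m t lam) β
      = laurentAct (annihilator m t) m (inverseSeq m t lam) (β.natAbs : ℤ) := by
    rcases Int.natAbs_eq β with h | h
    · rw [← h]
    · conv_lhs => rw [h]
      exact laurentAct_even hs (inverseSeq_neg m t lam) _
  rw [habs, main]
  have hk : ∀ k, lam k ≠ 0 := fun k => (hlam k).2.ne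
  rcases h : β.natAbs with _ | _ | n
  · have h0 : β = 0 := by omega
    rw [if_pos rfl, if_pos h0]
    simp [add_comm]
  · have h0 : β ≠ 0 := by omega
    have h1 : |β| = 1 := by rw [Int.abs_eq_natAbs, h]; rfl
    have h2 : (0 : ℕ) + 1 ≠ 0 := by omega
    rw [if_neg h0, if_pos h1, if_neg h2, if_pos rfl, add_comm]
    congr 1
    refine Finset.sum_congr rfl fun k _ => ?_
    have := hk k
    field_simp
    ring
  · have h0 : β ≠ 0 := by omega
    have h1 : |β| ≠ 1 := by rw [Int.abs_eq_natAbs, h]; omega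
    have h2 : n + 1 + 1 ≠ 0 := by omega
    have h3 : n + 1 + 1 ≠ 1 := by omega
    rw [if_neg h0, if_neg h1, if_neg h2, if_neg h3, add_zero]
    refine Finset.sum_congr rfl fun k _ => ?_
    have := hk k
    rw [Nat.add_sub_cancel, pow_succ _ (n + 1)]
    field_simp

theorem explicitD_eq {ω h : ℝ} {lam : Fin (m - 1) → ℝ} (hm : 2 ≤ m) (hp : (polyP m (h * ω)).coeff (2 * m - 2) ≠ 0)
    (hinj : Function.Injective lam)
    (hlam : ∀ i, lam i ∈ Set.Ioo (-1 : ℝ) 0) (hroot : ∀ i, (polyP m (h * ω)).eval (lam i) = 0) :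
    explicitD m ω h lam = fun β => 2 * ω ^ (2 * m - 1) * (-1) ^ m
      * laurentAct (annihilator m (h * ω)) m (inverseSeq m (h * ω) lam) β := by
  funext β
  rw [explicitD, ← coeff_mul_laurentAct_annihilator hm hp hinj hlam hroot]
  rcases neg_one_pow_eq_or ℝ m with h | h <;> rw [h] <;> field_simp

end

/-! ### Growth of the Green sequence and summability -/

theorem sample_greenFun {m : ℕ} {ω h : ℝ} (hh : 0 < h) (β : ℤ) :
    sample h (greenFun m ω) β = (-1) ^ m / (4 * ω ^ (2 * m - 1)) * greenSeq m (h * ω) β := by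
  have hy : ω * (h * β) = h * ω * β := by ring
  have hb : greenFun m ω (h * β) = (-1) ^ m * Real.sign (h * β) / (4 * ω ^ (2 * m - 1))
      * greenBracket m (h * ω * β) := by
    rw [greenFun, greenBracket, hy]
  rw [sample, hb, greenSeq]
  rcases lt_trichotomy β 0 with hβ | rfl | hβ
  · have h1 : (β : ℝ) < 0 := by exact_mod_cast hβ
    rw [Real.sign_of_neg (mul_neg_of_pos_of_neg hh h1), Nat.cast_natAbs, abs_of_neg hβ]
    push_cast
    rw [mul_neg (h * ω), greenBracket_neg]
    ring
  · simp [greenBracket_zero_right]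
  · have h1 : (0 : ℝ) < β := by exact_mod_cast hβ
    rw [Real.sign_of_pos (mul_pos hh h1), Nat.cast_natAbs, abs_of_pos hβ]
    ring

theorem abs_greenSeq_le {m : ℕ} (hm : 2 ≤ m) {t : ℝ} (ht : 0 < t) (n : ℤ) :
    |greenSeq m t n| ≤ 2 * (1 + n.natAbs * t) ^ (2 * (m - 1) + 1) := by
  have h1 := iterKernel_even_eq (m - 1) (t * n.natAbs)
  have h2 := abs_iterKernel_le (2 * (m - 1)) (y := t * n.natAbs) (by positivity)
  rw [Nat.sub_add_cancel (by omega)] at h1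
  rw [h1, abs_div, abs_mul, abs_pow, abs_neg, abs_one, one_pow, one_mul, abs_two] at h2
  rw [greenSeq, mul_comm _ t]
  linarith

theorem summable_int_pow_mul {x c t : ℝ} (hx : |x| < 1) (hc : 0 ≤ c) (ht : 0 ≤ t) (k : ℕ) :
    Summable fun γ : ℤ => (1 + (c + γ.natAbs * t)) ^ k * |x| ^ γ.natAbs := by
  rw [summable_int_iff_summable_nat_and_neg]
  simp only [Int.natAbs_natCast, Int.natAbs_neg, and_self]
  exact summable_pow_mul_abs_pow hx hc ht k

theorem intConvSummable_inverseSeq {m : ℕ} (hm : 2 ≤ m) {t : ℝ} (ht : 0 < t) {lam : Fin (m - 1) → ℝ}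
    (hlam : ∀ i, lam i ∈ Set.Ioo (-1 : ℝ) 0) : IntConvSummable (inverseSeq m t lam) (greenSeq m t) := by
  intro β
  have h : ∀ k, Summable fun γ : ℤ => lam k ^ γ.natAbs * greenSeq m t (β - γ) := by
    intro k
    have hx : |lam k| < 1 := abs_lt.mpr ⟨(hlam k).1, (hlam k).2.trans zero_lt_one⟩
    refine Summable.of_norm_bounded ((summable_int_pow_mul hx (c := β.natAbs * t) (by positivity) ht.le
      (2 * (m - 1) + 1)).mul_left 2) fun γ => ?_
    rw [norm_mul, norm_pow, Real.norm_eq_abs, Real.norm_eq_abs]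
    have h1 := abs_greenSeq_le hm ht (β - γ)
    have h2 : ((β - γ).natAbs : ℝ) ≤ β.natAbs + γ.natAbs := by
      exact_mod_cast Int.natAbs_sub_le β γ
    have h3 : (1 + ((β - γ).natAbs : ℝ) * t) ^ (2 * (m - 1) + 1)
        ≤ (1 + (β.natAbs * t + γ.natAbs * t)) ^ (2 * (m - 1) + 1) := by
      gcongr
      nlinarith
    calc |lam k| ^ γ.natAbs * |greenSeq m t (β - γ)|
        ≤ |lam k| ^ γ.natAbs * (2 * (1 + (β.natAbs * t + γ.natAbs * t)) ^ (2 * (m - 1) + 1)) := by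
          gcongr
          linarith
      _ = _ := by ring
  simp only [inverseSeq, Finset.sum_mul]
  refine summable_sum fun k _ => ?_
  simp_rw [mul_assoc]
  exact (h k).mul_left _

theorem summable_inverseSeq {m : ℕ} {t : ℝ} {lam : Fin (m - 1) → ℝ}
    (hlam : ∀ i, lam i ∈ Set.Ioo (-1 : ℝ) 0) : Summable fun n => |inverseSeq m t lam n| := by
  refine Summable.abs (summable_sum fun k _ => Summable.mul_left _ ?_)
  have hx : |lam k| < 1 := abs_lt.mpr ⟨(hlam k).1, (hlam k).2.trans zero_lt_one⟩
  refine Summable.of_norm_bounded (summable_int_pow_mul hx le_rfl le_rfl 0) fun γ => ?_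
  simp

theorem intConvSummable_of_bounded {x y : ℤ → ℝ} {B : ℝ} (hx : ∀ n, |x n| ≤ B)
    (hy : Summable fun n => |y n|) : IntConvSummable x y := by
  intro β
  have h1 : Summable fun γ => |y (β - γ)| := (Equiv.subLeft β).summable_iff.mpr hy
  refine Summable.of_norm_bounded (h1.mul_left B) fun γ => ?_
  rw [norm_mul, Real.norm_eq_abs, Real.norm_eq_abs]
  exact mul_le_mul_of_nonneg_right (hx γ) (abs_nonneg _)

theorem tendsto_atTop_of_hasDerivAt {f g : ℝ → ℝ} (hf : ∀ y, HasDerivAt f (g y) y)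
    (hg : Filter.Tendsto g Filter.atTop Filter.atTop) : Filter.Tendsto f Filter.atTop Filter.atTop := by
  obtain ⟨Y, hY⟩ := Filter.eventually_atTop.mp (hg.eventually_ge_atTop 1)
  have hmono : MonotoneOn (fun y => f y - y) (Set.Ici Y) := by
    have hd : ∀ y, HasDerivAt (fun y => f y - y) (g y - 1) y := fun y => (hf y).sub (hasDerivAt_id y)
    refine monotoneOn_of_deriv_nonneg (convex_Ici Y)
      (fun y _ => (hd y).continuousAt.continuousWithinAt)
      (fun y _ => (hd y).differentiableAt.differentiableWithinAt) fun y hy => ?_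
    rw [(hd y).deriv]
    rw [interior_Ici] at hy
    linarith [hY y (Set.mem_Ioi.mp hy).le]
  refine Filter.tendsto_atTop_mono' _ ?_ (Filter.tendsto_atTop_add_const_left _ (f Y - Y) Filter.tendsto_id)
  filter_upwards [Filter.eventually_ge_atTop Y] with y hy
  have := hmono (Set.mem_Ici.mpr le_rfl) (Set.mem_Ici.mpr hy) hy
  simp only [id] at *
  linarith

/-- For index 3 the signed bracket is at least `y - 3`; each further index integrates twice. -/
theorem greenBracket_tendsto (m : ℕ) :
    Filter.Tendsto (fun y => (-1) ^ (m + 3) * greenBracket (m + 3) y) Filter.atTop Filter.atTop := by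
  induction m with
  | zero =>
    refine Filter.tendsto_atTop_mono' _ ?_ (Filter.tendsto_atTop_add_const_right _ (-3) Filter.tendsto_id)
    filter_upwards [Filter.eventually_ge_atTop 0] with y hy
    have h1 := Real.sin_le_one y
    have h2 := mul_le_mul_of_nonneg_left (Real.neg_one_le_cos y) hy
    simp [greenBracket_eq_sum_range]
    linarith
  | succ m ih =>
    obtain ⟨F, -, hF, hF'⟩ := greenBracket_deriv_two (m + 2)
    have h1 : Filter.Tendsto (fun y => (-1) ^ (m + 4) * F y) Filter.atTop Filter.atTop :=
      tendsto_atTop_of_hasDerivAt (fun y => ((hF' y).const_mul _).congr_deriv (by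
        rw [pow_succ _ (m + 3)]
        ring)) ih
    exact tendsto_atTop_of_hasDerivAt (fun y => (hF y).const_mul _) h1

/-- For index 2 the bracket oscillates through 0, so two neighbouring values are needed: `sin t ≤
|cos y| + |cos(y + t)|` prevents both cosines from being small. -/
theorem greenBracket_lower_bound {m : ℕ} (hm : 2 ≤ m) {t : ℝ} (ht : 0 < t) (ht1 : t ≤ 1) :
    ∀ᶠ y in Filter.atTop, 1 ≤ |greenBracket m y| + |greenBracket m (y + t)| := by
  obtain rfl | ⟨j, rfl⟩ : m = 2 ∨ ∃ j, m = j + 3 := by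
    rcases hm.eq_or_lt with h | h
    · exact Or.inl h.symm
    · exact Or.inr ⟨m - 3, by omega⟩
  · have hst : 0 < Real.sin t := Real.sin_pos_of_pos_of_le_one ht ht1
    -- The 3 pays for the two errors `|sin| ≤ 1` and leaves 1.
    filter_upwards [Filter.eventually_ge_atTop (3 / Real.sin t), Filter.eventually_ge_atTop 0] with y h1 h2
    rw [div_le_iff₀ hst] at h1
    have hb : ∀ y, 0 ≤ y → y * |Real.cos y| - 1 ≤ |greenBracket 2 y| := by
      intro y hy
      have h3 : greenBracket 2 y = Real.sin y - y * Real.cos y := by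
        simp [greenBracket]
        ring
      have h4 := abs_sub_abs_le_abs_sub (y * Real.cos y) (Real.sin y)
      rw [h3, abs_sub_comm]
      rw [abs_mul, abs_of_nonneg hy] at h4
      linarith [Real.abs_sin_le_one y]
    have h3 := hb y h2
    have h4 := hb (y + t) (by linarith)
    have h5 : Real.sin t ≤ |Real.cos y| + |Real.cos (y + t)| := by
      have e : Real.sin t = Real.sin (y + t) * Real.cos y - Real.cos (y + t) * Real.sin y := by
        rw [← Real.sin_sub]
        ring_nf
      have e1 := abs_sub (Real.sin (y + t) * Real.cos y) (Real.cos (y + t) * Real.sin y)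
      rw [abs_mul, abs_mul] at e1
      have e2 := mul_le_of_le_one_left (abs_nonneg (Real.cos y)) (Real.abs_sin_le_one (y + t))
      have e3 := mul_le_of_le_one_right (abs_nonneg (Real.cos (y + t))) (Real.abs_sin_le_one y)
      rw [e]
      exact (le_abs_self _).trans (by linarith)
    have h6 := mul_le_mul_of_nonneg_left h5 h2
    have h7 := mul_nonneg ht.le (abs_nonneg (Real.cos (y + t)))
    linarith
  · filter_upwards [(greenBracket_tendsto j).eventually_ge_atTop 1] with y hy
    have h1 := (hy.trans (le_abs_self _))
    rw [abs_mul, abs_pow, abs_neg, abs_one, one_pow, one_mul] at h1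
    linarith [abs_nonneg (greenBracket (j + 3) (y + t))]

theorem greenSeq_lower_bound {m : ℕ} (hm : 2 ≤ m) {t : ℝ} (ht : 0 < t) (ht1 : t ≤ 1) :
    ∃ K : ℕ, ∀ n : ℤ, K ≤ n.natAbs → 1 ≤ |greenSeq m t n| + |greenSeq m t (n + 1)| := by
  obtain ⟨Y, hY⟩ := Filter.eventually_atTop.mp (greenBracket_lower_bound hm ht ht1)
  obtain ⟨K, hK⟩ := exists_nat_ge (Y / t)
  rw [div_le_iff₀ ht] at hK
  have key : ∀ a : ℕ, K ≤ a → 1 ≤ |greenBracket m (t * a)| + |greenBracket m (t * (a + 1 : ℕ))| := by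
    intro a ha
    have h1 : (K : ℝ) ≤ a := by exact_mod_cast ha
    have h2 := hY (t * a) (by nlinarith)
    rwa [show t * (a : ℝ) + t = t * (a + 1 : ℕ) by push_cast; ring] at h2
  refine ⟨K + 1, fun n hn => ?_⟩
  simp only [greenSeq]
  rcases le_or_gt 0 n with h | h
  · rw [show (n + 1).natAbs = n.natAbs + 1 by omega]
    exact key _ (by omega)
  · have h1 := key (n + 1).natAbs (by omega)
    rw [show (n + 1).natAbs + 1 = n.natAbs by omega] at h1
    linarith

/-- Absolute convergence at `β = 0` and at `β = 1` bounds `|x n|` times two consecutive values of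
`greenSeq`, whose sum is at least 1 away from finitely many `n`. -/
theorem bounded_of_intConvSummable {m : ℕ} (hm : 2 ≤ m) {t : ℝ} (ht : 0 < t) (ht1 : t ≤ 1) {x : ℤ → ℝ}
    (hx : IntConvSummable x (greenSeq m t)) : ∃ B, ∀ n, |x n| ≤ B := by
  obtain ⟨K, hK⟩ := greenSeq_lower_bound hm ht ht1
  have h0 := (hx 0).abs
  have h1 := (hx 1).abs
  have hfin : (Set.Icc (-(K : ℤ)) K).Finite := Set.finite_Icc _ _
  obtain ⟨B, hB⟩ := (hfin.image fun n => |x n|).bddAbove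
  refine ⟨max B ((∑' γ : ℤ, |x γ * greenSeq m t (0 - γ)|) + ∑' γ : ℤ, |x γ * greenSeq m t (1 - γ)|), fun n => ?_⟩
  rcases lt_or_ge n.natAbs K with hn | hn
  · exact le_max_of_le_left (hB ⟨n, ⟨by omega, by omega⟩, rfl⟩)
  · refine le_max_of_le_right ?_
    have e0 := h0.le_tsum n fun _ _ => abs_nonneg _
    have e1 := h1.le_tsum n fun _ _ => abs_nonneg _
    have e2 := hK (0 - n) (by omega)
    rw [show (0 - n + 1 : ℤ) = 1 - n by ring] at e2
    rw [abs_mul] at e0 e1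
    have e3 := mul_le_mul_of_nonneg_left e2 (abs_nonneg (x n))
    linarith

/-! ### Existence and uniqueness of the discrete inverse -/

section

variable {m : ℕ} {t : ℝ} {lam : Fin (m - 1) → ℝ}

theorem intConv_laurentAct_inverseSeq_greenSeq (hm : 2 ≤ m) (ht : 0 < t)
    (hp : (polyP m t).coeff (2 * m - 2) ≠ 0) (hinj : Function.Injective lam)
    (hlam : ∀ i, lam i ∈ Set.Ioo (-1 : ℝ) 0) (hroot : ∀ i, (polyP m t).eval (lam i) = 0) (β : ℤ) :
    HasSum (fun γ => laurentAct (annihilator m t) m (inverseSeq m t lam) γ * greenSeq m t (β - γ))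
      (2 * discreteDelta β) := by
  have hs := intConvSummable_inverseSeq hm ht hlam
  have h := hasSum_laurentAct_left hs (annihilator m t) m β
  have h1 : intConv (inverseSeq m t lam) (fun n => 2 * laurentAct (polyP m t) (m - 1) discreteDelta n)
      = fun n => 2 * laurentAct (polyP m t) (m - 1) (inverseSeq m t lam) n := by
    rw [← laurentAct_const_mul, intConv_laurentAct_right, ← laurentAct_const_mul]
    · congr 1
      funext n
      have := (hasSum_discreteDelta (inverseSeq m t lam) n).mul_left 2
      rw [intConv, ← this.tsum_eq]
      exact tsum_congr fun γ => by ring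
    · intro β
      exact ((hasSum_discreteDelta (inverseSeq m t lam) β).mul_left 2).summable.congr fun γ => by ring
  rw [← intConv_laurentAct_right hs, laurentAct_greenSeq hm, h1,
    laurentAct_polyP_inverseSeq hm hp hinj hlam hroot] at h
  exact h

/-- Applying the annihilator gives `𝒫 · x = 0`, and then `x = x * δ = x * (𝒫 · inverseSeq) = (𝒫 · x)
* inverseSeq = 0`. Only finite operators are moved across convolutions, so associativity of infinite
convolutions is not needed; boundedness of `x` makes the last convolution converge. -/
theorem eq_zero_of_intConv_greenSeq_eq_zero (hm : 2 ≤ m) (ht : 0 < t) (ht1 : t ≤ 1)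
    (hp : (polyP m t).coeff (2 * m - 2) ≠ 0) (hinj : Function.Injective lam)
    (hlam : ∀ i, lam i ∈ Set.Ioo (-1 : ℝ) 0) (hroot : ∀ i, (polyP m t).eval (lam i) = 0) {x : ℤ → ℝ}
    (hx : IntConvSummable x (greenSeq m t)) (h0 : intConv x (greenSeq m t) = 0) : x = 0 := by
  obtain ⟨B, hB⟩ := bounded_of_intConvSummable hm ht ht1 hx
  have hxr := intConvSummable_of_bounded hB (summable_inverseSeq (m := m) (t := t) hlam)
  have h1 := intConv_laurentAct_right hx (annihilator m t) m
  have hd := intConvSummable_discreteDelta x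
  rw [h0, laurentAct_zero, laurentAct_greenSeq hm] at h1
  have h2 : intConv x (laurentAct (polyP m t) (m - 1) discreteDelta) = 0 := by
    funext β
    have h3 := congrFun h1 β
    simp only [intConv, mul_left_comm _ (2 : ℝ)] at h3 ⊢
    rw [tsum_mul_left] at h3
    simpa using h3
  rw [intConv_laurentAct_right hd, intConv_discreteDelta] at h2
  calc x = intConv x discreteDelta := (intConv_discreteDelta x).symm
    _ = intConv x (laurentAct (polyP m t) (m - 1) (inverseSeq m t lam)) := by
      rw [laurentAct_polyP_inverseSeq hm hp hinj hlam hroot]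
    _ = intConv (laurentAct (polyP m t) (m - 1) x) (inverseSeq m t lam) := by
      rw [intConv_laurentAct_right hxr, intConv_laurentAct_left hxr]
    _ = 0 := by rw [h2, intConv_zero_left]

end

theorem convolutionEq_iff_eq_explicitD {m : ℕ} (hm : 2 ≤ m) {ω h : ℝ} (hω : 0 < ω) (hh : 0 < h)
    (hhω : h * ω ≤ 1) {lam : Fin (m - 1) → ℝ} (hp : (polyP m (h * ω)).coeff (2 * m - 2) ≠ 0)
    (hinj : Function.Injective lam) (hlam : ∀ i, lam i ∈ Set.Ioo (-1 : ℝ) 0)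
    (hroot : ∀ i, (polyP m (h * ω)).eval (lam i) = 0) (D : ℤ → ℝ) :
    ConvolutionEq D (sample h (greenFun m ω)) discreteDelta ↔ D = explicitD m ω h lam := by
  have ht : 0 < h * ω := mul_pos hh hω
  have hc : (-1 : ℝ) ^ m / (4 * ω ^ (2 * m - 1)) ≠ 0 := by positivity
  have hex : ∀ β, HasSum (fun γ => explicitD m ω h lam γ * sample h (greenFun m ω) (β - γ)) (discreteDelta β) := by
    intro β
    have h1 := (intConv_laurentAct_inverseSeq_greenSeq hm ht hp hinj hlam hroot β).mul_left (1 / 2)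
    rw [explicitD_eq hm hp hinj hlam hroot]
    simp_rw [sample_greenFun hh]
    rw [← mul_assoc, one_div, inv_mul_cancel₀ two_ne_zero, one_mul] at h1
    refine h1.congr_fun fun γ => ?_
    have : ω ^ (2 * m - 1) ≠ 0 := by positivity
    rcases neg_one_pow_eq_or ℝ m with e | e <;> rw [e] <;> field_simp <;> ring
  constructor
  · intro hD
    -- Uniqueness is linear: the difference of two solutions is annihilated by convolution with
    -- `greenSeq`.
    have hzero : ∀ β, HasSum (fun γ => (D γ - explicitD m ω h lam γ) * greenSeq m (h * ω) (β - γ)) 0 := by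
      intro β
      have h1 : HasSum (fun γ => D γ * sample h (greenFun m ω) (β - γ)) (discreteDelta β) := by
        have h2 := (hD β).1.of_abs.hasSum
        rwa [(hD β).2] at h2
      have h2 := (h1.sub (hex β)).mul_left ((-1 : ℝ) ^ m / (4 * ω ^ (2 * m - 1)))⁻¹
      rw [sub_self, mul_zero] at h2
      refine h2.congr_fun fun γ => ?_
      rw [sample_greenFun hh]
      field_simp
    have h3 := eq_zero_of_intConv_greenSeq_eq_zero hm ht hhω hp hinj hlam hroot
      (x := fun γ => D γ - explicitD m ω h lam γ) (fun β => (hzero β).summable)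
      (funext fun β => (hzero β).tsum_eq)
    funext β
    exact sub_eq_zero.mp (congrFun h3 β)
  · rintro rfl β
    exact ⟨(hex β).summable.abs, (hex β).tsum_eq⟩

end

theorem theorem3p1 (m : ℕ) (hm : 2 ≤ m) (ω : ℝ) (hω : 0 < ω) (N : ℕ) (hN : 1 ≤ N)
    (h : ℝ) (hh : h = 1 / (N : ℝ)) (hhω : h * ω ≤ 1) :
    (polyP m (h * ω)).natDegree = 2 * m - 2 ∧
    (polyP m (h * ω)).coeff (2 * m - 2)
      = (2 * (m : ℝ) - 3) * Real.sin (h * ω) - h * ω * Real.cos (h * ω)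
        + 2 * ∑ k ∈ Finset.Icc 1 (m - 2),
            (-1) ^ k * ((m : ℝ) - k - 1) * (h * ω) ^ (2 * k - 1)
              / (Nat.factorial (2 * k - 1) : ℝ) ∧
    ∃ lam : Fin (m - 1) → ℝ,
      Function.Injective lam ∧
      (∀ z : ℂ, (Polynomial.aeval z (polyP m (h * ω)) = 0 ∧ ‖z‖ < 1) ↔
        ∃ k, ((lam k : ℝ) : ℂ) = z) ∧
      (∀ k, lam k ≠ 0 ∧ (Polynomial.derivative (polyP m (h * ω))).eval (lam k) ≠ 0) ∧
      ∀ D : ℤ → ℝ,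
        ConvolutionEq D (sample h (greenFun m ω)) discreteDelta ↔
          D = explicitD m ω h lam := by
  have hh0 : 0 < h := by
    have : (0 : ℝ) < N := by exact_mod_cast hN
    rw [hh]
    positivity
  have ht : 0 < h * ω := mul_pos hh0 hω
  have hp : (polyP m (h * ω)).coeff (2 * m - 2) ≠ 0 := by
    rw [polyP_leadingCoeff_eq hm]
    exact polyP_eval_zero_ne_zero hm ht hhω
  obtain ⟨lam, hinj, hlam⟩ := exists_zeros_polyP hm ht hhω
  refine ⟨natDegree_eq_of_le_of_coeff_ne_zero (polyP_natDegree_le hm _) hp, ?_, lam, hinj, ?_, ?_, ?_⟩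
  · rw [polyP_leadingCoeff_eq hm, polyP_eval_zero]
  · exact polyP_aeval_eq_zero_iff hm hp hinj (fun i => (hlam i).1) fun i => (hlam i).2
  · exact fun k => ⟨(hlam k).1.2.ne,
      polyP_derivative_eval_ne_zero hm hp hinj (fun i => (hlam i).1) (fun i => (hlam i).2) k⟩
  · exact convolutionEq_iff_eq_explicitD hm hω hh0 hhω hp hinj (fun i => (hlam i).1) fun i => (hlam i).2
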